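/- Let $d$ be a natural number, $I_d=\{1,\dots,d\}$, $\mathbb R_+=[0,\infty)$, with standard basis $e_1,\dots,e_d$ of $\mathbb R^d$. All Hilbert spaces are complex and separable. An isometric representation of $\mathbb R_+^d$ on a Hilbert space $H$ is a strongly continuous family $V=(V_t)_{t\in\mathbb R_+^d}$ of isometries of $H$ with $V_0=1$ and $V_{s+t}=V_sV_t$. It is doubly commuting if $V_{se_i}V_{te_j}^*=V_{te_j}^*V_{se_i}$ for all $i\ne j$ and $s,t\ge 0$, and irreducible if $H\neq 0$ and the commutant of $\{V_t,V_t^*: t\in\mathbb R_+^d\}$ is $\mathbb C 1$. We write $\sim$ for unitary equivalence. For $A\subset I_d$ let $Y_A=\mathbb R^{A^c}$ be the set of all maps $A^c=I_d\setminus A\to\mathbb R$. For $\lambda\in Y_A$ let $V^{(A,\lambda)}$ be the isometric representation of $\mathbb R_+^d$ on $L^2(\mathbb R_+^d)$ given by $$V^{(A,\lambda)}_tf(x)=\begin{cases}e^{i\sum_{j\in A^c}t_j\lambda_j}\,f\bigl(x-\sum_{k\in A}t_ke_k\bigr)&\text{if }x-\sum_{k\in A}t_ke_k\in\mathbb R_+^d,\\0&\text{otherwise,}\end{cases}$$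 and let $V^{(A,\lambda,|A|)}$ be the isometric representation of $\mathbb R_+^d$ on $L^2(\mathbb R_+^{A})$ given by $$V^{(A,\lambda,|A|)}_tf(x)=\begin{cases}e^{i\sum_{j\in A^c}t_j\lambda_j}\,f\bigl(x-(t_k)_{k\in A}\bigr)&\text{if }x-(t_k)_{k\in A}\in\mathbb R_+^A,\\0&\text{otherwise.}\end{cases}$$ Let $\mathcal K$ be an infinite-dimensional separable Hilbert space and $\mathcal H=L^2(\mathbb R_+^d)\otimes\mathcal K$. A railway representation on $\mathcal H$ is an isometric representation of $\mathbb R_+^d$ on $\mathcal H$ that is unitarily equivalent to $\bigoplus_{n=1}^\infty V_0$ for some irreducible isometric representation $V_0$ of $\mathbb R_+^d$. Give the set $\mathscr R$ of railway representations on $\mathcal H$ the topology with basis the sets $$X(V,K,\epsilon,F)=\Bigl\{W\in\mathscr R:\ \max_{\xi\in F}\ \sup_{t\in K}\ \max\bigl(\|(V_t-W_t)\xi\|,\ \|(V_t^*-W_t^*)\xi\|\bigr)<\epsilon\Bigr\},$$ where $V\in\mathscr R$, $K\subset\mathbb R_+^d$ is compact, $\epsilon>0$ and $F\subset\mathcal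 H$ is finite and non-empty. Give $\mathcal R=\mathscr R/\!\sim$ the quotient topology (the Fell topology), and $\mathcal R_0(\mathbb R_+^d)=\{[V]\in\mathcal R: V\text{ doubly commuting}\}$ the subspace topology. Theorem. 1. For all $A\subset I_d$ and $\lambda\in Y_A$, the representation $V^{(A,\lambda,|A|)}$ is irreducible and doubly commuting. Conversely, every irreducible doubly commuting isometric representation of $\mathbb R_+^d$ on a separable Hilbert space is unitarily equivalent to $V^{(A,\lambda,|A|)}$ for exactly one pair $(A,\lambda)$ with $A\subset I_d$, $\lambda\in Y_A$. 2. For all $A\subset I_d$ and $\lambda\in Y_A$, $V^{(A,\lambda)}\otimes 1_{\mathcal K}$ is a doubly commuting railway representation on $\mathcal H$, and the map $$\Psi:\coprod_{A\subset I_d}Y_A\to\mathcal R_0(\mathbb R_+^d),\qquad(A,\lambda)\mapsto[V^{(A,\lambda)}\otimes 1_{\mathcal K}],$$ is a bijection. 3. The Fell topology on $\mathcal R_0(\mathbb R_+^d)$ is $T_0$. -/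

import Mathlib

open MeasureTheory
open scoped NNReal ENNReal TensorProduct

noncomputable section

namespace FellTop

/-! ### Isometric representations of a topological semigroup -/

section General

variable (S : Type*) [AddMonoid S] [TopologicalSpace S]

/-- A (strongly continuous) isometric representation of `S` on the Hilbert space `H`. -/
structure IsoRep (H : Type*) [NormedAddCommGroup H] [InnerProductSpace ℂ H] where
  op : S → H →L[ℂ] H
  norm_op : ∀ s x, ‖op s x‖ = ‖x‖
  op_zero : op 0 = 1
  op_add : ∀ s t, op (s + t) = op s ∘L op t
  strongly_continuous : ∀ x, Continuous fun s => op s x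

variable {S}
variable {H : Type*} [NormedAddCommGroup H] [InnerProductSpace ℂ H]
variable {H' : Type*} [NormedAddCommGroup H'] [InnerProductSpace ℂ H']

/-- Unitary equivalence of isometric representations. -/
def UnitarilyEquiv (V : IsoRep S H) (W : IsoRep S H') : Prop :=
  ∃ U : H ≃ₗᵢ[ℂ] H', ∀ s x, U (V.op s x) = W.op s (U x)

/-- Irreducibility: the commutant of `{V_s, V_s^* : s ∈ S}` consists of the scalars (and the space
is non-zero). -/
def IsIrred [CompleteSpace H] (V : IsoRep S H) : Prop :=
  Nontrivial H ∧ ∀ T : H →L[ℂ] H,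
    (∀ s, T ∘L V.op s = V.op s ∘L T ∧
      T ∘L ContinuousLinearMap.adjoint (V.op s) = ContinuousLinearMap.adjoint (V.op s) ∘L T) →
    ∃ c : ℂ, T = c • (1 : H →L[ℂ] H)

/-- `V` is unitarily equivalent to the direct sum of countably infinitely many copies of `V₀`,
acting on the Hilbert space direct sum `⨁_{n ∈ ℕ} E`. -/
def IsInfiniteMultiple (V : IsoRep S H) (V₀ : IsoRep S H') : Prop :=
  ∃ U : H ≃ₗᵢ[ℂ] lp (fun _ : ℕ => H') 2, ∀ s x n, U (V.op s x) n = V₀.op s (U x n)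

/-- Railway representations: countably infinite multiples of an irreducible isometric
representation. (The space of the irreducible representation embeds into `H`, hence it is enough
to look for it in the universe of `H`.) -/
def IsRailway.{u} {H : Type u} [NormedAddCommGroup H] [InnerProductSpace ℂ H]
    (V : IsoRep S H) : Prop :=
  ∃ (E : Type u) (_ : NormedAddCommGroup E) (_ : InnerProductSpace ℂ E) (_ : CompleteSpace E)
    (V₀ : IsoRep S E), IsIrred V₀ ∧ IsInfiniteMultiple V V₀

variable (S H)

/-- The set of railway representations of `S` on the fixed Hilbert space `H`. -/
def Railway : Type _ := {V : IsoRep S H // IsRailway V}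

variable {S H}

/-- The basic set `X(V, K, ε, F)`: the railway representations `W` such that the supremum over
`ξ ∈ F` and `x ∈ K` of `‖(V_x - W_x) ξ‖` and `‖(V_x^* - W_x^*) ξ‖` is smaller than `ε`. -/
def basicSet [CompleteSpace H] (V : Railway S H) (K : Set S) (ε : ℝ) (F : Finset H) :
    Set (Railway S H) :=
  {W | ∃ δ < ε, ∀ ξ ∈ F, ∀ x ∈ K, ‖V.1.op x ξ - W.1.op x ξ‖ ≤ δ ∧
    ‖ContinuousLinearMap.adjoint (V.1.op x) ξ - ContinuousLinearMap.adjoint (W.1.op x) ξ‖ ≤ δ}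

/-- The topology on the set of railway representations generated by the sets `X(V, K, ε, F)` with
`K` compact, `ε > 0` and `F` finite and non-empty. -/
instance [CompleteSpace H] : TopologicalSpace (Railway S H) :=
  TopologicalSpace.generateFrom
    {X | ∃ (V : Railway S H) (K : Set S) (ε : ℝ) (F : Finset H),
      IsCompact K ∧ 0 < ε ∧ F.Nonempty ∧ X = basicSet V K ε F}

variable (S H)

/-- Unitary equivalence as an equivalence relation on the railway representations on `H`. -/
def railwaySetoid : Setoid (Railway S H) where
  r V W := UnitarilyEquiv V.1 W.1
  iseqv :=
    { refl := fun _ => ⟨LinearIsometryEquiv.refl ℂ H, fun _ _ => rfl⟩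
      symm := by
        rintro V W ⟨U, hU⟩
        refine ⟨U.symm, fun s x => ?_⟩
        rw [LinearIsometryEquiv.symm_apply_eq, hU, LinearIsometryEquiv.apply_symm_apply]
      trans := by
        rintro V W Z ⟨U, hU⟩ ⟨U', hU'⟩
        exact ⟨U.trans U', fun s x => by simp [hU, hU']⟩ }

/-- `R(S)`: the set of unitary equivalence classes of railway representations. -/
def RailwayClass : Type _ := Quotient (railwaySetoid S H)

/-- The Fell topology: the quotient topology. -/
instance [CompleteSpace H] : TopologicalSpace (RailwayClass S H) :=
  inferInstanceAs (TopologicalSpace (Quotient (railwaySetoid S H)))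

variable {S H}

/-- The class `[V]` of a railway representation. -/
def Railway.cls (V : Railway S H) : RailwayClass S H := Quotient.mk (railwaySetoid S H) V

/-! ### Hilbert space tensor products -/

/-- The Hilbert space tensor product. -/
abbrev HilbertTensor (E K : Type*) [NormedAddCommGroup E] [InnerProductSpace ℂ E]
    [NormedAddCommGroup K] [InnerProductSpace ℂ K] : Type _ :=
  UniformSpace.Completion (E ⊗[ℂ] K)

theorem continuous_of_dense_of_lipschitz {T D X : Type*} [TopologicalSpace T]
    [NormedAddCommGroup X] (f : T → X → X) (hf : ∀ t, LipschitzWith 1 (f t)) {e : D → X}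
    (he : DenseRange e) (h : ∀ z, Continuous fun t => f t (e z)) (x : X) :
    Continuous fun t => f t x := by
  have hmain : Continuous fun p : X × T => f p.2 p.1 := by
    refine continuous_prod_of_dense_continuous_lipschitzWith _ 1 he ?_ hf
    rintro _ ⟨z, rfl⟩
    exact h z
  exact hmain.comp (Continuous.prodMk continuous_const continuous_id)

section Tensor

variable {E : Type*} [NormedAddCommGroup E] [InnerProductSpace ℂ E]
variable (K : Type*) [NormedAddCommGroup K] [InnerProductSpace ℂ K]

/-- The isometry `V_s ⊗ 1` on the algebraic tensor product. -/
def IsoRep.algTensorOne (V : IsoRep S E) (s : S) : E ⊗[ℂ] K →ₗᵢ[ℂ] E ⊗[ℂ] K :=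
  LinearIsometry.rTensor K
    (⟨(V.op s : E →ₗ[ℂ] E), fun x => V.norm_op s x⟩ : E →ₗᵢ[ℂ] E)

theorem IsoRep.algTensorOne_tmul (V : IsoRep S E) (s : S) (x : E) (y : K) :
    V.algTensorOne K s (x ⊗ₜ[ℂ] y) = V.op s x ⊗ₜ[ℂ] y := rfl

/-- The bounded operator `V_s ⊗ 1` on the Hilbert space tensor product. -/
def IsoRep.tensorOneOp (V : IsoRep S E) (s : S) : HilbertTensor E K →L[ℂ] HilbertTensor E K :=
  ContinuousLinearMap.completion (V.algTensorOne K s).toContinuousLinearMap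

theorem IsoRep.tensorOneOp_coe (V : IsoRep S E) (s : S) (x : E ⊗[ℂ] K) :
    V.tensorOneOp K s x = ((V.algTensorOne K s x : E ⊗[ℂ] K) : HilbertTensor E K) :=
  UniformSpace.Completion.map_coe (V.algTensorOne K s).toContinuousLinearMap.uniformContinuous x

theorem IsoRep.tensorOneOp_norm (V : IsoRep S E) (s : S) (x : HilbertTensor E K) :
    ‖V.tensorOneOp K s x‖ = ‖x‖ := by
  induction x using UniformSpace.Completion.induction_on with
  | hp => exact isClosed_eq (by fun_prop) (by fun_prop)
  | ih x => rw [V.tensorOneOp_coe K, UniformSpace.Completion.norm_coe,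
      UniformSpace.Completion.norm_coe, LinearIsometry.norm_map]

theorem IsoRep.tensorOneOp_lipschitz (V : IsoRep S E) (s : S) :
    LipschitzWith 1 (V.tensorOneOp K s) :=
  (⟨(V.tensorOneOp K s : HilbertTensor E K →ₗ[ℂ] HilbertTensor E K), V.tensorOneOp_norm K s⟩ :
    HilbertTensor E K →ₗᵢ[ℂ] HilbertTensor E K).lipschitz

theorem IsoRep.tensorOneOp_ext {T T' : HilbertTensor E K →L[ℂ] HilbertTensor E K}
    (h : ∀ (x : E) (y : K), T ((x ⊗ₜ[ℂ] y : E ⊗[ℂ] K) : HilbertTensor E K)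
      = T' ((x ⊗ₜ[ℂ] y : E ⊗[ℂ] K) : HilbertTensor E K)) : T = T' := by
  ext z
  induction z using UniformSpace.Completion.induction_on with
  | hp => exact isClosed_eq (by fun_prop) (by fun_prop)
  | ih z =>
    induction z using TensorProduct.induction_on with
    | zero => rw [UniformSpace.Completion.coe_zero, map_zero, map_zero]
    | tmul x y => exact h x y
    | add x y hx hy => rw [UniformSpace.Completion.coe_add, map_add, map_add, hx, hy]

/-- The representation `V ⊗ 1_K` on the Hilbert space tensor product `E ⊗ K`. -/
def IsoRep.tensorOne (V : IsoRep S E) : IsoRep S (HilbertTensor E K) where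
  op := V.tensorOneOp K
  norm_op := V.tensorOneOp_norm K
  op_zero := by
    refine IsoRep.tensorOneOp_ext K fun x y => ?_
    rw [V.tensorOneOp_coe K, V.algTensorOne_tmul K, V.op_zero]
    rfl
  op_add s t := by
    refine IsoRep.tensorOneOp_ext K fun x y => ?_
    rw [ContinuousLinearMap.comp_apply, V.tensorOneOp_coe K, V.tensorOneOp_coe K, V.tensorOneOp_coe K,
      V.algTensorOne_tmul K, V.algTensorOne_tmul K, V.algTensorOne_tmul K, V.op_add]
    rfl
  strongly_continuous x := by
    refine continuous_of_dense_of_lipschitz (fun s y => V.tensorOneOp K s y)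
      (V.tensorOneOp_lipschitz K) (UniformSpace.Completion.denseRange_coe (α := E ⊗[ℂ] K))
      (fun z => ?_) x
    simp only [V.tensorOneOp_coe K]
    refine (UniformSpace.Completion.continuous_coe _).comp ?_
    induction z using TensorProduct.induction_on with
    | zero => simpa using continuous_const
    | tmul x y =>
      simp only [V.algTensorOne_tmul K]
      exact TensorProduct.continuous_tmul.comp
        ((V.strongly_continuous x).prodMk continuous_const)
    | add x y hx hy => simp only [map_add]; exact hx.add hy

end Tensor

end General

/-! ### Doubly commuting representations of `ℝ₊^d` -/

/-- `V` is doubly commuting: for `i ≠ j`, the operators `V_{s e_i}` and `V_{t e_j}^*` commute. -/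
def DoublyCommuting {d : ℕ} {H : Type*} [NormedAddCommGroup H] [InnerProductSpace ℂ H]
    [CompleteSpace H] (V : IsoRep (Fin d → ℝ≥0) H) : Prop :=
  ∀ i j : Fin d, i ≠ j → ∀ s t : ℝ≥0,
    V.op (Pi.single i s) ∘L ContinuousLinearMap.adjoint (V.op (Pi.single j t)) =
      ContinuousLinearMap.adjoint (V.op (Pi.single j t)) ∘L V.op (Pi.single i s)

/-- `R₀(ℝ₊^d)`: the set of classes `[V]` of doubly commuting railway representations. As a subtype
of `RailwayClass`, it carries the subspace topology of the Fell topology. -/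
def R₀ (d : ℕ) (H : Type*) [NormedAddCommGroup H] [InnerProductSpace ℂ H] [CompleteSpace H] :
    Set (RailwayClass (Fin d → ℝ≥0) H) :=
  {c | ∃ V : Railway (Fin d → ℝ≥0) H, V.cls = c ∧ DoublyCommuting V.1}

/-! ### Shifts on `L²(ℝ₊^ι)` -/

section Shift

variable (ι : Type*) [Fintype ι]

/-- Lebesgue measure on the cone `ℝ₊^ι`. -/
abbrev coneMeasure : Measure (ι → ℝ) := (volume : Measure (ι → ℝ)).restrict (Set.Ici 0)

/-- The Hilbert space `L²(ℝ₊^ι)`. -/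
abbrev L2Cone : Type _ := Lp ℂ 2 (coneMeasure ι)

variable {ι}

theorem memLp_extendZero (f : L2Cone ι) :
    MemLp ((Set.Ici (0 : ι → ℝ)).indicator f) 2 (volume : Measure (ι → ℝ)) :=
  (memLp_indicator_iff_restrict measurableSet_Ici).2 (Lp.memLp f)

/-- Extension by zero, `L²(ℝ₊^ι) → L²(ℝ^ι)`. -/
def extendZero : L2Cone ι →ₗᵢ[ℂ] Lp ℂ 2 (volume : Measure (ι → ℝ)) where
  toFun f := MemLp.toLp _ (memLp_extendZero f)
  map_add' f g := by
    rw [← MemLp.toLp_add, MemLp.toLp_eq_toLp_iff, ← Set.indicator_add',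
      ← ae_eq_restrict_iff_indicator_ae_eq measurableSet_Ici]
    exact Lp.coeFn_add f g
  map_smul' c f := by
    rw [RingHom.id_apply, ← MemLp.toLp_const_smul, MemLp.toLp_eq_toLp_iff]
    change _ =ᵐ[volume] fun x => c • (Set.Ici (0 : ι → ℝ)).indicator f x
    simp_rw [← Set.indicator_const_smul_apply]
    rw [← ae_eq_restrict_iff_indicator_ae_eq measurableSet_Ici]
    exact Lp.coeFn_smul c f
  norm_map' f := by
    change ‖MemLp.toLp _ (memLp_extendZero f)‖ = ‖f‖
    rw [Lp.norm_toLp, eLpNorm_indicator_eq_eLpNorm_restrict measurableSet_Ici, Lp.norm_def]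

theorem extendZero_coeFn (f : L2Cone ι) :
    extendZero f =ᵐ[volume] (Set.Ici (0 : ι → ℝ)).indicator f :=
  MemLp.coeFn_toLp (memLp_extendZero f)

/-- Translation `g ↦ g(· - a)` on `L²(ℝ^ι)`. -/
def translate (a : ι → ℝ) :
    Lp ℂ 2 (volume : Measure (ι → ℝ)) →ₗᵢ[ℂ] Lp ℂ 2 (volume : Measure (ι → ℝ)) :=
  Lp.compMeasurePreservingₗᵢ ℂ (fun x => x - a) (measurePreserving_sub_right volume a)

theorem translate_coeFn (a : ι → ℝ) (g : Lp ℂ 2 (volume : Measure (ι → ℝ))) :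
    translate a g =ᵐ[volume] fun x => g (x - a) :=
  Lp.coeFn_compMeasurePreserving g (measurePreserving_sub_right volume a)

theorem continuous_translate (g : Lp ℂ 2 (volume : Measure (ι → ℝ))) :
    Continuous fun a => translate a g := by
  have hc : Continuous fun a : ι → ℝ => (⟨fun x => x - a, by fun_prop⟩ : C(ι → ℝ, ι → ℝ)) :=
    ContinuousMap.continuous_of_continuous_uncurry _ (by simp [Function.uncurry_def]; fun_prop)
  exact (continuous_const (y := g)).compMeasurePreservingLp hc
    (fun a => measurePreserving_sub_right volume a) (by simp)

/-- The shift `S_τ` on `L²(ℝ₊^ι)`: extend by zero, translate by `τ`, restrict to `ℝ₊^ι`. That is,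
`(S_τ f)(x) = f(x - τ)` if `x - τ ∈ ℝ₊^ι`, and `0` otherwise (see `shift_coeFn`). -/
def shift (τ : ι → ℝ≥0) : L2Cone ι →L[ℂ] L2Cone ι :=
  LpToLpRestrictCLM (ι → ℝ) ℂ ℂ volume 2 (Set.Ici 0) ∘L
    ((translate fun k => (τ k : ℝ)).comp extendZero).toContinuousLinearMap

theorem translate_extendZero_coeFn (a : ι → ℝ) (f : L2Cone ι) :
    translate a (extendZero f) =ᵐ[volume] fun x => (Set.Ici (0 : ι → ℝ)).indicator f (x - a) :=
  (translate_coeFn a _).trans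
    ((measurePreserving_sub_right volume a).quasiMeasurePreserving.ae_eq_comp (extendZero_coeFn f))

open Classical in
theorem shift_coeFn (τ : ι → ℝ≥0) (f : L2Cone ι) :
    shift τ f =ᵐ[coneMeasure ι] fun x =>
      if ∀ k, 0 ≤ x k - (τ k : ℝ) then f (fun k => x k - (τ k : ℝ)) else 0 := by
  refine (LpToLpRestrictCLM_coeFn ℂ _ _).trans ?_
  filter_upwards [ae_restrict_of_ae
    (translate_extendZero_coeFn (fun k => (τ k : ℝ)) f)] with x hx
  refine hx.trans ?_
  rw [Set.indicator_apply]
  exact if_congr Iff.rfl rfl rfl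

theorem extendZero_shift (τ : ι → ℝ≥0) (f : L2Cone ι) :
    extendZero (shift τ f) = translate (fun k => (τ k : ℝ)) (extendZero f) := by
  apply Lp.ext
  refine (extendZero_coeFn _).trans ?_
  have h1 := (ae_eq_restrict_iff_indicator_ae_eq measurableSet_Ici).1
    (LpToLpRestrictCLM_coeFn ℂ (Set.Ici (0 : ι → ℝ))
      (translate (fun k => (τ k : ℝ)) (extendZero f)))
  refine h1.trans ?_
  filter_upwards [translate_extendZero_coeFn (fun k => (τ k : ℝ)) f] with x hx
  by_cases h : x ∈ Set.Ici (0 : ι → ℝ)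
  · rw [Set.indicator_of_mem h]
  · rw [Set.indicator_of_notMem h, hx, Set.indicator_of_notMem]
    intro h'
    refine h fun k => ?_
    have := h' k
    simp only [Pi.zero_apply, Pi.sub_apply] at this ⊢
    linarith [(τ k).2]

theorem norm_shift (τ : ι → ℝ≥0) (f : L2Cone ι) : ‖shift τ f‖ = ‖f‖ := by
  rw [← extendZero.norm_map, extendZero_shift, LinearIsometry.norm_map, LinearIsometry.norm_map]

theorem shift_zero : shift (0 : ι → ℝ≥0) = 1 := by
  ext1 f
  apply extendZero.injective
  rw [extendZero_shift]
  apply Lp.ext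
  refine (translate_coeFn _ (extendZero f)).trans (Filter.Eventually.of_forall fun x => ?_)
  have : (x - fun k => (((0 : ι → ℝ≥0) k : ℝ≥0) : ℝ)) = x := by ext; simp
  simp only [this]
  rfl

theorem shift_add (τ σ : ι → ℝ≥0) : shift (τ + σ) = shift τ ∘L shift σ := by
  ext1 f
  apply extendZero.injective
  rw [ContinuousLinearMap.comp_apply, extendZero_shift, extendZero_shift, extendZero_shift]
  apply Lp.ext
  refine (translate_coeFn _ _).trans ?_
  refine Filter.EventuallyEq.trans ?_ (translate_coeFn _ _).symm
  refine Filter.EventuallyEq.trans ?_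
    ((measurePreserving_sub_right volume _).quasiMeasurePreserving.ae_eq_comp
      (translate_coeFn _ _)).symm
  refine .of_forall fun x => ?_
  simp only [Function.comp_apply]
  congr 1
  ext k
  simp
  ring

theorem continuous_shift (f : L2Cone ι) : Continuous fun τ : ι → ℝ≥0 => shift τ f := by
  rw [extendZero.isometry.isEmbedding.continuous_iff]
  simp only [Function.comp_def, extendZero_shift]
  exact (continuous_translate _).comp (by fun_prop)

end Shift

/-! ### The representations `V^{(A,λ)}` -/

section Model

variable {d : ℕ}

/-- The parameter set `∐_{A ⊆ {1, …, d}} Y_A`, where `Y_A` is the set of all maps `A^c → ℝ`. -/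
abbrev Param (d : ℕ) : Type := Σ A : Finset (Fin d), ({j : Fin d // j ∉ A} → ℝ)

/-- The character `t ↦ e^{i ∑_{j ∈ A^c} t_j λ_j}`. -/
def phase (p : Param d) (t : Fin d → ℝ≥0) : ℂ :=
  Complex.exp (Complex.I * ((∑ j : {j : Fin d // j ∉ p.1}, (t j : ℝ) * p.2 j : ℝ) : ℂ))

theorem norm_phase (p : Param d) (t : Fin d → ℝ≥0) : ‖phase p t‖ = 1 := by
  rw [phase, mul_comm]
  exact Complex.norm_exp_ofReal_mul_I _

theorem phase_zero (p : Param d) : phase p 0 = 1 := by simp [phase]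

theorem phase_add (p : Param d) (s t : Fin d → ℝ≥0) :
    phase p (s + t) = phase p s * phase p t := by
  rw [phase, phase, phase, ← Complex.exp_add, ← mul_add, ← Complex.ofReal_add,
    ← Finset.sum_add_distrib]
  simp [add_mul]

theorem continuous_phase (p : Param d) : Continuous (phase p) := by
  unfold phase
  fun_prop

/-- The representation `t ↦ e^{i ∑_{j ∈ A^c} t_j λ_j} S_{r(t)}` on `L²(ℝ₊^ι)`, for a continuous
additive map `r : ℝ₊^d → ℝ₊^ι`. -/
def twistedShift {ι : Type*} [Fintype ι] (p : Param d) (r : (Fin d → ℝ≥0) →+ (ι → ℝ≥0))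
    (hr : Continuous r) : IsoRep (Fin d → ℝ≥0) (L2Cone ι) where
  op t := phase p t • shift (r t)
  norm_op t f := by
    rw [smul_apply, norm_smul, norm_phase, norm_shift, one_mul]
  op_zero := by rw [phase_zero, map_zero, shift_zero, one_smul]
  op_add s t := by
    rw [phase_add, map_add, shift_add]
    ext1 f
    simp [mul_smul, smul_comm (phase p s)]
  strongly_continuous f :=
    (continuous_phase p).smul ((continuous_shift f).comp hr)

/-- The isometric representation `V^{(A,λ)}` of `ℝ₊^d` on `L²(ℝ₊^d)`:
`(V_t f)(x) = e^{i ∑_{j ∈ A^c} t_j λ_j} f(x - ∑_{k ∈ A} t_k e_k)` if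
`x - ∑_{k ∈ A} t_k e_k ∈ ℝ₊^d`, and `0` otherwise. -/
def modelRep (p : Param d) : IsoRep (Fin d → ℝ≥0) (L2Cone (Fin d)) :=
  twistedShift p
    { toFun := fun t k => if k ∈ p.1 then t k else 0
      map_zero' := by ext; simp
      map_add' := fun s t => by ext k; by_cases h : k ∈ p.1 <;> simp [h] }
    (continuous_pi fun k => by
      by_cases h : k ∈ p.1 <;> simp [h] <;> fun_prop)

/-- The isometric representation `V^{(A,λ,|A|)}` of `ℝ₊^d` on `L²(ℝ₊^A)`:
`(V_t f)(x) = e^{i ∑_{j ∈ A^c} t_j λ_j} f(x - (t_k)_{k ∈ A})` if `x - (t_k)_{k ∈ A} ∈ ℝ₊^A`, and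
`0` otherwise. -/
def irredRep (p : Param d) : IsoRep (Fin d → ℝ≥0) (L2Cone {k : Fin d // k ∈ p.1}) :=
  twistedShift p
    { toFun := fun t k => t k
      map_zero' := rfl
      map_add' := fun _ _ => rfl }
    (continuous_pi fun k => by simp; fun_prop)

open Classical in
theorem modelRep_coeFn (p : Param d) (t : Fin d → ℝ≥0) (f : L2Cone (Fin d)) :
    (modelRep p).op t f =ᵐ[coneMeasure (Fin d)] fun x =>
      if ∀ k, 0 ≤ x k - (if k ∈ p.1 then (t k : ℝ) else 0) then
        Complex.exp (Complex.I *
            ((∑ j : {j : Fin d // j ∉ p.1}, (t j : ℝ) * p.2 j : ℝ) : ℂ)) *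
          f (fun k => x k - (if k ∈ p.1 then (t k : ℝ) else 0))
      else 0 := by
  refine (Lp.coeFn_smul (phase p t) _).trans ?_
  filter_upwards [shift_coeFn (fun k => if k ∈ p.1 then t k else 0) f] with x hx
  rw [Pi.smul_apply]
  erw [hx]
  simp only [apply_ite NNReal.toReal, NNReal.coe_zero]
  split_ifs
  · rfl
  · simp

end Model

end FellTop

end

noncomputable section

namespace FellTop

open ContinuousLinearMap (adjoint)

/-! ### One-parameter contraction semigroups -/

/-! Everything rests on vacuum vectors: joint eigenvectors `w` of the adjoints `V_t^*`, with
eigenvalue `e^{-t}` along the axes in `A` and `e^{-itλ_j}` along the others. Double commutation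
gives `V_s^* V_t w = c(s - t) V_{t - s} w` with truncated subtraction (`IsVacuum.adjoint_op_op`), so
the Gram matrix of the orbit of `w` depends only on `(A, λ)` and `‖w‖`. Hence two doubly commuting
representations with cyclic vacuum vectors of the same type are unitarily equivalent. They are
irreducible, because an operator in the commutant maps `w` to a multiple of `w`.

Existence in an irreducible `V`: for each axis the intersection of the ranges of `V_{te_i}` is
reducing, hence `0` or everything. If it is everything, `V_{te_i}` lies in the commutant and is a
character. Otherwise an eigenvector is produced from the resolvent `R = (1 - A)⁻¹` at 1 of the
generator `A`. The Cayley transform `1 - 2R` is an isometry; a vector orthogonal to its range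
satisfies `R^* w = w/2`, that is, `V_t^* w = e^{-t} w`, and if the range is everything the semigroup
is unitary. The eigenspaces reduce the other axes, so induction gives a joint eigenvector
(`IsIrred.exists_isVacuum`).

In `L²(ℝ₊^A)` the function `e^{-∑ x_k}` is a vacuum vector. It is cyclic because its shifts are
multiples of its restrictions to translated orthants, and orthants generate the Borel sets. The
representation `V^{(A,λ)} ⊗ 1` is generated by an infinite-dimensional space of vacuum vectors; an
orthonormal basis of that space splits it into countably many copies of `V^{(A,λ,|A|)}`
(`isInfiniteMultiple_of_vacuum`).

Uniqueness, injectivity and `T₀` come from one invariant: for which `j` and `m` the axis `j` acts by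
the character of frequency `m`. This determines `(A, λ)`, is unchanged by unitary equivalence and by
passing to infinite multiples, and is a closed condition in the Fell topology. -/

/-- A strongly continuous one-parameter semigroup of contractions. -/
structure ContractionSemigroup (H : Type*) [NormedAddCommGroup H] [InnerProductSpace ℂ H] where
  op : ℝ≥0 → H →L[ℂ] H
  norm_op_le : ∀ s x, ‖op s x‖ ≤ ‖x‖
  op_zero : op 0 = 1
  op_add : ∀ s t x, op (s + t) x = op s (op t x)
  strongly_continuous : ∀ x, Continuous fun s => op s x

namespace ContractionSemigroup

variable {H : Type*} [NormedAddCommGroup H] [InnerProductSpace ℂ H] (C : ContractionSemigroup H)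

theorem continuous_orbit (x : H) : Continuous fun t : ℝ => C.op t.toNNReal x :=
  (C.strongly_continuous x).comp continuous_real_toNNReal

/-- If the orbit of `x` has right derivative `y` at `0`, then it has right derivative `C_s y`
at `s`. -/
theorem hasDerivWithinAt_orbit {x y : H}
    (h : HasDerivWithinAt (fun t : ℝ => C.op t.toNNReal x) y (Set.Ici 0) 0) {s : ℝ} (hs : 0 ≤ s) :
    HasDerivWithinAt (fun t : ℝ => C.op t.toNNReal x) (C.op s.toNNReal y) (Set.Ici s) s := by
  have h1 : HasDerivWithinAt (fun t : ℝ => C.op (t - s).toNNReal x) y (Set.Ici s) s := by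
    have h2 : HasDerivWithinAt (fun t : ℝ => t - s) 1 (Set.Ici s) s :=
      ((hasDerivAt_id s).sub_const s).hasDerivWithinAt
    have h3 := HasDerivWithinAt.scomp (h := fun t : ℝ => t - s) (t' := Set.Ici 0) s
      (by simpa using h) h2 (fun t ht => by simpa using ht)
    simpa [Function.comp_def] using h3
  have h4 := (((C.op s.toNNReal).restrictScalars ℝ).hasFDerivAt
    (x := C.op (s - s).toNNReal x)).comp_hasDerivWithinAt s h1
  refine h4.congr_of_mem (fun t ht => ?_) Set.self_mem_Ici
  have : t.toNNReal = s.toNNReal + (t - s).toNNReal := by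
    rw [← Real.toNNReal_add hs (by simpa using ht)]
    congr 1
    ring
  rw [this, C.op_add]
  rfl

/-- The resolvent at `1`, as the Laplace transform of the semigroup. -/
def laplace (x : H) : H := ∫ t in Set.Ioi (0 : ℝ), Real.exp (-t) • C.op t.toNNReal x

theorem integrableOn_laplace (x : H) (a : ℝ) :
    IntegrableOn (fun t : ℝ => Real.exp (-t) • C.op t.toNNReal x) (Set.Ioi a) := by
  refine ((integrableOn_exp_neg_Ioi a).mul_const ‖x‖).mono' ?_ (.of_forall fun t => ?_)
  · exact (Continuous.fun_smul (by fun_prop) (C.continuous_orbit x)).aestronglyMeasurable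
  · rw [norm_smul, Real.norm_eq_abs, abs_of_pos (Real.exp_pos _)]
    gcongr
    exact C.norm_op_le _ _

theorem norm_laplace_le (x : H) : ‖C.laplace x‖ ≤ ‖x‖ := by
  refine (norm_integral_le_of_norm_le ((integrableOn_exp_neg_Ioi 0).mul_const ‖x‖)
    (.of_forall fun t => ?_)).trans ?_
  · rw [norm_smul, Real.norm_eq_abs, abs_of_pos (Real.exp_pos _)]
    gcongr
    exact C.norm_op_le _ _
  · rw [integral_mul_const, integral_exp_neg_Ioi_zero, one_mul]

/-- The resolvent at `1` as a bounded operator. -/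
def resolvent : H →L[ℂ] H :=
  LinearMap.mkContinuous
    { toFun := C.laplace
      map_add' := fun x y => by
        simp only [laplace, map_add, smul_add]
        exact integral_add (C.integrableOn_laplace x 0) (C.integrableOn_laplace y 0)
      map_smul' := fun c x => by
        simp only [laplace, map_smul, RingHom.id_apply]
        rw [← integral_smul]
        congr 1 with t
        exact smul_comm _ _ _ } 1
    (fun x => by simpa using C.norm_laplace_le x)

/-- A vector whose orbit has right derivative `k • x` at `0` is an eigenvector. -/
theorem op_eq_exp_smul {x : H} {k : ℂ}
    (h : HasDerivWithinAt (fun t : ℝ => C.op t.toNNReal x) (k • x) (Set.Ici 0) 0) (s : ℝ≥0) :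
    C.op s x = Complex.exp (k * s) • x := by
  -- Multiplying the orbit by `e^{-kt}` cancels the derivative, so the product is constant.
  have hd : ∀ t ∈ Set.Ico (0 : ℝ) s, HasDerivWithinAt
      (fun t : ℝ => Complex.exp (-(k * t)) • C.op t.toNNReal x) 0 (Set.Ici t) t := by
    intro t ht
    have h1 := C.hasDerivWithinAt_orbit h ht.1
    have h2 : HasDerivAt (fun t : ℝ => Complex.exp (-(k * t)))
        (Complex.exp (-(k * t)) * (-(k * 1))) t :=
      (((hasDerivAt_id _).ofReal_comp.const_mul k).neg).cexp
    refine (h2.hasDerivWithinAt.smul h1).congr_deriv ?_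
    rw [map_smul, smul_smul, ← add_smul]
    simp
  have h0 := constant_of_has_deriv_right_zero (Continuous.continuousOn
    (Continuous.fun_smul (by fun_prop) (C.continuous_orbit x))) hd s ⟨s.2, le_rfl⟩
  simp only [Real.toNNReal_coe, Complex.ofReal_zero, mul_zero, neg_zero, Complex.exp_zero, one_smul,
    Real.toNNReal_zero, C.op_zero, one_apply_eq_self] at h0
  rw [← h0, smul_smul, ← Complex.exp_add, add_neg_cancel, Complex.exp_zero, one_smul, h0]

/-- If the squared norm has vanishing right derivatives along the orbit of `x`, the orbit lies on a
sphere. -/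
theorem norm_op_eq {x y : H}
    (h : HasDerivWithinAt (fun t : ℝ => C.op t.toNNReal x) y (Set.Ici 0) 0)
    (hxy : ∀ s : ℝ≥0, RCLike.re (inner ℂ (C.op s x) (C.op s y)) = 0) (s : ℝ≥0) :
    ‖C.op s x‖ = ‖x‖ := by
  let _ : InnerProductSpace ℝ H := InnerProductSpace.rclikeToReal ℂ H
  have hd : ∀ t ∈ Set.Ico (0 : ℝ) s, HasDerivWithinAt
      (fun t : ℝ => ‖C.op t.toNNReal x‖ ^ 2) 0 (Set.Ici t) t := by
    intro t ht
    refine (C.hasDerivWithinAt_orbit h ht.1).norm_sq.congr_deriv ?_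
    rw [real_inner_eq_re_inner, hxy, mul_zero]
  have h0 := constant_of_has_deriv_right_zero (Continuous.continuousOn
    ((C.continuous_orbit x).norm.fun_pow 2)) hd s ⟨s.2, le_rfl⟩
  simp only [Real.toNNReal_coe, Real.toNNReal_zero, C.op_zero,
    one_apply_eq_self] at h0
  exact (pow_left_inj₀ (norm_nonneg _) (norm_nonneg _) two_ne_zero).1 h0

variable [CompleteSpace H]

/-- The substitution `t ↦ t + h` turns `C_h R x` into `e^h ∫_h^∞ e^{-t} C_t x dt`. Written with the
integral over `[0, h]`, this is visibly differentiable in `h`. -/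
theorem op_resolvent (x : H) {h : ℝ} (hh : 0 ≤ h) :
    C.op h.toNNReal (C.resolvent x) = Real.exp h •
      (C.resolvent x - ∫ t in (0 : ℝ)..h, Real.exp (-t) • C.op t.toNNReal x) := by
  have h1 : C.op h.toNNReal (C.resolvent x) =
      ∫ t in Set.Ioi (0 : ℝ), C.op h.toNNReal (Real.exp (-t) • C.op t.toNNReal x) :=
    (ContinuousLinearMap.integral_comp_comm (C.op h.toNNReal) (C.integrableOn_laplace x 0)).symm
  have h2 := (measurePreserving_add_right volume h).setIntegral_preimage_emb
    (measurableEmbedding_addRight h)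
    (fun t : ℝ => Real.exp (-t) • C.op t.toNNReal x) (Set.Ioi h)
  have h3 := intervalIntegral.integral_interval_add_Ioi (C.integrableOn_laplace x 0)
    (C.integrableOn_laplace x h)
  have h4 : C.resolvent x - (∫ t in (0 : ℝ)..h, Real.exp (-t) • C.op t.toNNReal x) =
      ∫ t in Set.Ioi h, Real.exp (-t) • C.op t.toNNReal x := by
    rw [sub_eq_iff_eq_add']
    exact h3.symm
  rw [h1, h4, ← h2, ← integral_smul]
  have h5 : (fun t => t + h) ⁻¹' Set.Ioi h = Set.Ioi (0 : ℝ) := by ext; simp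
  rw [h5]
  refine setIntegral_congr_fun measurableSet_Ioi fun t ht => ?_
  have ht' : (0 : ℝ) ≤ t := le_of_lt ht
  rw [← Complex.coe_smul, map_smul, ← C.op_add, smul_smul, ← Real.exp_add, Complex.coe_smul,
    add_comm t h, Real.toNNReal_add hh ht']
  congr 2
  ring

/-- This is the identity `A R = R - 1` for the generator `A`, so that no unbounded operator has to
be introduced. -/
theorem hasDerivWithinAt_resolvent (x : H) :
    HasDerivWithinAt (fun t : ℝ => C.op t.toNNReal (C.resolvent x)) (C.resolvent x - x)
      (Set.Ici 0) 0 := by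
  have hc : Continuous fun t : ℝ => Real.exp (-t) • C.op t.toNNReal x :=
    Continuous.fun_smul (by fun_prop) (C.continuous_orbit x)
  have h1 : HasDerivAt (fun h : ℝ => ∫ t in (0 : ℝ)..h, Real.exp (-t) • C.op t.toNNReal x)
      (Real.exp (-0) • C.op (0 : ℝ).toNNReal x) 0 :=
    intervalIntegral.integral_hasDerivAt_right (hc.intervalIntegrable _ _)
      (hc.stronglyMeasurableAtFilter _ _) hc.continuousAt
  have h2 := (Real.hasDerivAt_exp 0).smul (h1.const_sub (C.resolvent x))
  have h3 : HasDerivWithinAt (fun h : ℝ => Real.exp h •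
      (C.resolvent x - ∫ t in (0 : ℝ)..h, Real.exp (-t) • C.op t.toNNReal x))
      (C.resolvent x - x) (Set.Ici 0) 0 := by
    refine (h2.hasDerivWithinAt).congr_deriv ?_
    simp [C.op_zero]
    abel
  exact h3.congr_of_mem (fun t ht => C.op_resolvent x ht) Set.self_mem_Ici

theorem resolvent_injective {x : H} (hx : C.resolvent x = 0) : x = 0 := by
  have h := C.hasDerivWithinAt_resolvent x
  simp only [hx, map_zero, zero_sub] at h
  have := (uniqueDiffOn_Ici (0 : ℝ) 0 Set.self_mem_Ici).eq_deriv _ h (hasDerivWithinAt_const _ _ _)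
  simpa using this

end ContractionSemigroup

variable {H : Type*} [NormedAddCommGroup H] [InnerProductSpace ℂ H]

namespace IsoRep

variable {S : Type*} [AddMonoid S] [TopologicalSpace S] (V : IsoRep S H)

theorem inner_op_op (s : S) (x y : H) : inner ℂ (V.op s x) (V.op s y) = inner ℂ x y :=
  (⟨(V.op s : H →ₗ[ℂ] H), V.norm_op s⟩ : H →ₗᵢ[ℂ] H).inner_map_map x y

variable [CompleteSpace H]

theorem adjoint_op_op (s : S) (x : H) : adjoint (V.op s) (V.op s x) = x := by
  refine ext_inner_right ℂ fun y => ?_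
  rw [ContinuousLinearMap.adjoint_inner_left, inner_op_op]

theorem norm_adjoint_op_le (s : S) (x : H) : ‖adjoint (V.op s) x‖ ≤ ‖x‖ := by
  refine (ContinuousLinearMap.le_opNorm _ _).trans ?_
  rw [LinearIsometryEquiv.norm_map]
  refine mul_le_of_le_one_left (norm_nonneg _)
    (ContinuousLinearMap.opNorm_le_bound _ zero_le_one fun y => ?_)
  rw [V.norm_op, one_mul]

/-- For an isometry, `‖V V^* x - x‖² = ‖x‖² - ‖V^* x‖²`. -/
theorem op_adjoint_op_of_norm_eq {s : S} {x : H} (h : ‖adjoint (V.op s) x‖ = ‖x‖) :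
    V.op s (adjoint (V.op s) x) = x := by
  rw [← sub_eq_zero, ← norm_eq_zero, ← sq_eq_zero_iff, norm_sub_sq (𝕜 := ℂ),
    ← ContinuousLinearMap.adjoint_inner_right, inner_self_eq_norm_sq, V.norm_op, h]
  ring

end IsoRep

section OneParameter

variable [CompleteSpace H] (V : IsoRep ℝ≥0 H)

/-- The contraction semigroup of a one-parameter isometric representation. -/
def IsoRep.toContraction : ContractionSemigroup H where
  op := V.op
  norm_op_le s x := (V.norm_op s x).le
  op_zero := V.op_zero
  op_add s t x := by rw [V.op_add]; rfl
  strongly_continuous := V.strongly_continuous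

/-- Strong continuity does not pass to adjoints in general. Here the semigroup law and contractivity
reduce an increment to `V_t^* x - x`, whose squared norm is at most `2 ‖x‖ ‖V_t x - x‖`. -/
theorem IsoRep.continuous_adjoint_op (x : H) : Continuous fun s => adjoint (V.op s) x := by
  have key : ∀ s t : ℝ≥0, ‖adjoint (V.op (s + t)) x - adjoint (V.op s) x‖ ^ 2 ≤
      2 * (‖x‖ * ‖V.op t x - x‖) := by
    intro s t
    have h1 : adjoint (V.op (s + t)) x - adjoint (V.op s) x =
        adjoint (V.op s) (adjoint (V.op t) x - x) := by
      rw [add_comm, V.op_add, ContinuousLinearMap.adjoint_comp, map_sub]; rfl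
    have h2 : ‖adjoint (V.op t) x - x‖ ^ 2 ≤ 2 * (‖x‖ * ‖V.op t x - x‖) := by
      have h3 : RCLike.re (inner ℂ (adjoint (V.op t) x) x) =
          ‖x‖ ^ 2 + RCLike.re (inner ℂ x (V.op t x - x)) := by
        rw [ContinuousLinearMap.adjoint_inner_left, inner_sub_right, map_sub,
          inner_self_eq_norm_sq]; ring
      have h4 := (abs_le.1 ((RCLike.abs_re_le_norm (inner ℂ x (V.op t x - x))).trans
        (norm_inner_le_norm x (V.op t x - x)))).1
      have h5 := V.norm_adjoint_op_le t x
      rw [norm_sub_sq (𝕜 := ℂ), h3]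
      nlinarith [norm_nonneg (adjoint (V.op t) x)]
    rw [h1]
    refine le_trans ?_ h2
    have := V.norm_adjoint_op_le s (adjoint (V.op t) x - x)
    gcongr
  rw [continuous_iff_continuousAt]
  intro s
  -- With truncated subtraction, `(t - s) + (s - t)` is `|t - s|`, which treats both sides of `s` at
  -- once.
  have hb : Filter.Tendsto (fun t : ℝ≥0 => 2 * (‖x‖ * ‖V.op ((t - s) + (s - t)) x - x‖))
      (nhds s) (nhds 0) := by
    have : Continuous fun t : ℝ≥0 => 2 * (‖x‖ * ‖V.op ((t - s) + (s - t)) x - x‖) := by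
      have hc : Continuous fun t : ℝ≥0 => (t - s) + (s - t) := by fun_prop
      exact continuous_const.mul (continuous_const.mul
        ((((V.strongly_continuous x).comp hc).sub continuous_const).norm))
    have h0 := this.tendsto s
    simpa [V.op_zero] using h0
  rw [ContinuousAt, tendsto_iff_norm_sub_tendsto_zero]
  have hsq : Filter.Tendsto (fun t => ‖adjoint (V.op t) x - adjoint (V.op s) x‖ ^ 2)
      (nhds s) (nhds 0) := by
    refine squeeze_zero (fun _ => by positivity) (fun t => ?_) hb
    rcases le_total s t with h | h
    · have := key s (t - s)
      rw [add_tsub_cancel_of_le h] at this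
      simpa [tsub_eq_zero_of_le h] using this
    · rw [tsub_eq_zero_of_le h, zero_add, norm_sub_rev]
      have := key t (s - t)
      rwa [add_tsub_cancel_of_le h] at this
  have := hsq.sqrt
  simpa using this

/-- The contraction semigroup of the adjoints of a one-parameter isometric representation. -/
def IsoRep.adjointContraction : ContractionSemigroup H where
  op s := adjoint (V.op s)
  norm_op_le := V.norm_adjoint_op_le
  op_zero := by
    rw [V.op_zero]
    exact ContinuousLinearMap.adjoint_id
  op_add s t x := by rw [add_comm, V.op_add, ContinuousLinearMap.adjoint_comp]; rfl
  strongly_continuous := V.continuous_adjoint_op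

theorem IsoRep.adjoint_resolvent :
    adjoint V.toContraction.resolvent = V.adjointContraction.resolvent := by
  symm
  rw [ContinuousLinearMap.eq_adjoint_iff]
  intro x y
  have h1 : inner ℂ x (V.toContraction.resolvent y) = ∫ t in Set.Ioi (0 : ℝ),
      inner ℂ x (Real.exp (-t) • V.op t.toNNReal y) :=
    (integral_inner (V.toContraction.integrableOn_laplace y 0) x).symm
  have h2 : inner ℂ y (V.adjointContraction.resolvent x) = ∫ t in Set.Ioi (0 : ℝ),
      inner ℂ y (Real.exp (-t) • adjoint (V.op t.toNNReal) x) :=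
    (integral_inner (V.adjointContraction.integrableOn_laplace x 0) y).symm
  rw [← inner_conj_symm, h1, h2, ← integral_conj]
  congr 1 with t
  rw [inner_conj_symm, ← Complex.coe_smul, ← Complex.coe_smul, inner_smul_left, inner_smul_right,
    ContinuousLinearMap.adjoint_inner_left, Complex.conj_ofReal]

/-- The identity `Re ⟨R x, R x - x⟩ = 0`, which says that the Cayley transform `1 - 2R` of a
one-parameter isometric representation is an isometry. -/
theorem IsoRep.re_inner_resolvent (x : H) :
    RCLike.re (inner ℂ (V.toContraction.resolvent x) (V.toContraction.resolvent x - x)) = 0 := by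
  let _ : InnerProductSpace ℝ H := InnerProductSpace.rclikeToReal ℂ H
  have h := (V.toContraction.hasDerivWithinAt_resolvent x).norm_sq
  have h1 : ∀ t : ℝ, ‖V.toContraction.op t.toNNReal (V.toContraction.resolvent x)‖ ^ 2 =
      ‖V.toContraction.resolvent x‖ ^ 2 := fun t => by
    rw [show V.toContraction.op = V.op from rfl, V.norm_op]
  simp only [h1] at h
  have := (uniqueDiffOn_Ici (0 : ℝ) 0 Set.self_mem_Ici).eq_deriv _ h (hasDerivWithinAt_const _ _ _)
  rw [Real.toNNReal_zero, V.toContraction.op_zero, one_apply_eq_self,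
    real_inner_eq_re_inner ℂ] at this
  linarith

/-- A one-parameter isometric representation is unitary, or its adjoints have a joint
eigenvector with eigenvalues `e^{-t}`. -/
theorem IsoRep.exists_eigenvector_or_unitary :
    (∃ w : H, w ≠ 0 ∧ ∀ t : ℝ≥0, adjoint (V.op t) w = (Real.exp (-t) : ℂ) • w) ∨
      ∀ (t : ℝ≥0) (x : H), ‖adjoint (V.op t) x‖ = ‖x‖ := by
  set R := V.toContraction.resolvent with hR
  set R' := V.adjointContraction.resolvent with hR'
  have hadj : adjoint R = R' := V.adjoint_resolvent
  -- The eigenvalue `1/2` of `R'` corresponds to the kernel of `1 - 2R'`, the adjoint of the Cayley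
  -- transform.
  by_cases hw : ∃ w : H, w ≠ 0 ∧ R' w = (1 / 2 : ℂ) • w
  · obtain ⟨w, hw0, hw⟩ := hw
    refine Or.inl ⟨w, hw0, fun t => ?_⟩
    have h1 := V.adjointContraction.hasDerivWithinAt_resolvent w
    rw [← hR', hw] at h1
    -- The orbit of `R' w = w/2` has derivative `w/2 - w = -w/2`; doubling gives `-w` for the orbit
    -- of `w`.
    have h2 : HasDerivWithinAt (fun t : ℝ => V.adjointContraction.op t.toNNReal w)
        ((-1 : ℂ) • w) (Set.Ici 0) 0 := by
      have h3 := h1.const_smul (2 : ℂ)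
      simp only [map_smul] at h3
      convert! h3 using 1
      · ext t; simp
      · module
    have := V.adjointContraction.op_eq_exp_smul h2 t
    simpa [IsoRep.adjointContraction] using this
  · right
    push Not at hw
    -- `‖x - 2Rx‖² = ‖x‖² + 4 Re ⟨Rx, Rx - x⟩`, and the last term vanishes.
    let T : H →ₗᵢ[ℂ] H := ⟨((1 : H →L[ℂ] H) - (2 : ℂ) • R : H →L[ℂ] H), fun x => by
      have h := V.re_inner_resolvent x
      rw [← hR, inner_sub_right, map_sub, inner_self_eq_norm_sq] at h
      change ‖x - (2 : ℂ) • R x‖ = ‖x‖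
      rw [← pow_left_inj₀ (norm_nonneg _) (norm_nonneg _) two_ne_zero, norm_sub_sq (𝕜 := ℂ),
        ← inner_conj_symm, RCLike.conj_re, inner_smul_left, norm_smul]
      simp at h ⊢
      linarith⟩
    have hTapp : ∀ x, T x = x - (2 : ℂ) • R x := fun _ => rfl
    have hclosed : IsClosed (LinearMap.range T.toLinearMap : Set H) :=
      T.isometry.isClosedEmbedding.isClosed_range
    have htop : LinearMap.range T.toLinearMap = ⊤ := by
      have : CompleteSpace (LinearMap.range T.toLinearMap) := hclosed.completeSpace_coe
      rw [← Submodule.orthogonal_eq_bot_iff, Submodule.eq_bot_iff]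
      intro w hw'
      by_contra hw0
      refine hw w hw0 ?_
      refine ext_inner_left ℂ fun x => ?_
      have h := (Submodule.mem_orthogonal _ _).1 hw' (T x) ⟨x, rfl⟩
      rw [hTapp, inner_sub_left, inner_smul_left, sub_eq_zero] at h
      rw [← hadj, ContinuousLinearMap.adjoint_inner_right, inner_smul_right, h, map_ofNat]
      ring
    let U : H ≃ₗᵢ[ℂ] H := LinearIsometryEquiv.ofSurjective T (LinearMap.range_eq_top.1 htop)
    have hU : ∀ x, U x = x - (2 : ℂ) • R x := fun _ => rfl
    have hUs : ∀ x, U.symm x = x - (2 : ℂ) • R' x := fun x => by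
      refine ext_inner_left ℂ fun y => ?_
      rw [← U.inner_map_map, U.apply_symm_apply, hU, inner_sub_left, inner_sub_right,
        inner_smul_left, inner_smul_right, ← hadj, ContinuousLinearMap.adjoint_inner_right,
        map_ofNat]
    -- The inverse of the unitary `U` is `1 - 2R'`; its being isometric gives back the same identity
    -- for `R'`.
    have hre : ∀ x, RCLike.re (inner ℂ (R' x) (R' x - x)) = 0 := by
      intro x
      have h := U.symm.norm_map x
      rw [hUs, ← pow_left_inj₀ (norm_nonneg _) (norm_nonneg _) two_ne_zero,
        norm_sub_sq (𝕜 := ℂ), ← inner_conj_symm, RCLike.conj_re, inner_smul_left,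
        norm_smul] at h
      rw [inner_sub_right, map_sub, inner_self_eq_norm_sq]
      simp at h ⊢
      linarith
    have hcomm : ∀ (s : ℝ≥0) x, adjoint (V.op s) (R' x) = R' (adjoint (V.op s) x) := by
      intro s x
      have h1 := (ContinuousLinearMap.integral_comp_comm (adjoint (V.op s))
        (V.adjointContraction.integrableOn_laplace x 0)).symm
      refine h1.trans ?_
      change _ = ∫ t in Set.Ioi (0 : ℝ), _
      congr 1 with t
      rw [← Complex.coe_smul, map_smul, Complex.coe_smul]
      change _ • V.adjointContraction.op s _ = _ • _
      congr 1
      rw [← V.adjointContraction.op_add, add_comm, V.adjointContraction.op_add]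
      rfl
    -- Along the orbit of `R' x` the squared norm has derivative `2 Re ⟨R' y, R' y - y⟩ = 0` with `y
    -- = V_t^* x`.
    have hran : ∀ (s : ℝ≥0) x, ‖adjoint (V.op s) (R' x)‖ = ‖R' x‖ := fun s x =>
      V.adjointContraction.norm_op_eq (V.adjointContraction.hasDerivWithinAt_resolvent x)
        (fun t => by
          have := hre (adjoint (V.op t) x)
          rw [map_sub]
          change RCLike.re (inner ℂ (adjoint (V.op t) (R' x))
            (adjoint (V.op t) (R' x) - adjoint (V.op t) x)) = 0
          rw [hcomm]
          exact this) s
    -- The orthogonal complement of the range of `R'` is the kernel of its adjoint `R`, which is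
    -- injective.
    have hdense : DenseRange R' := by
      have h1 : (LinearMap.range (R' : H →ₗ[ℂ] H))ᗮ = ⊥ := by
        rw [Submodule.eq_bot_iff]
        intro x hx
        refine V.toContraction.resolvent_injective (ext_inner_left ℂ fun y => ?_)
        have := (Submodule.mem_orthogonal _ _).1 hx (R' y) ⟨y, rfl⟩
        rw [inner_zero_right, ← this, ← hR]
        change _ = inner ℂ (R' y) x
        rw [← hadj, ContinuousLinearMap.adjoint_inner_left]
      have h2 := Submodule.topologicalClosure_eq_top_iff.2 h1
      have h3 := Submodule.dense_iff_topologicalClosure_eq_top.2 h2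
      exact h3
    intro t
    refine fun x => congrFun
      (hdense.equalizer (adjoint (V.op t)).continuous.norm continuous_norm ?_) x
    ext y
    exact hran t y

end OneParameter

/-- Continuous unitary characters of `ℝ₊` are exponentials. -/
theorem exists_exp_of_character (c : ℝ≥0 → ℂ) (hc : Continuous c) (h0 : c 0 = 1)
    (hadd : ∀ s t, c (s + t) = c s * c t) (hnorm : ∀ t, ‖c t‖ = 1) :
    ∃ l : ℝ, ∀ t : ℝ≥0, c t = Complex.exp (Complex.I * ((t * l : ℝ) : ℂ)) := by
  -- A character is an isometric representation on `ℂ`; its resolvent supplies a nonzero vector with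
  -- a differentiable orbit.
  let V : IsoRep ℝ≥0 ℂ :=
    { op := fun t => c t • (1 : ℂ →L[ℂ] ℂ)
      norm_op := fun t x => by simp [hnorm]
      op_zero := by rw [h0, one_smul]
      op_add := fun s t => by ext; simp [hadd, mul_comm]
      strongly_continuous := fun x => by simpa using hc.fun_mul continuous_const }
  set r := V.toContraction.resolvent 1 with hr
  have hr0 : r ≠ 0 := fun h => one_ne_zero (V.toContraction.resolvent_injective h)
  have h1 := V.toContraction.hasDerivWithinAt_resolvent 1
  rw [← hr] at h1
  have h2 : r - 1 = ((r - 1) / r) • r := by rw [smul_eq_mul, div_mul_cancel₀ _ hr0]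
  rw [h2] at h1
  set k := (r - 1) / r
  have h3 : ∀ s : ℝ≥0, c s = Complex.exp (k * s) := fun s => by
    have := V.toContraction.op_eq_exp_smul h1 s
    change c s * r = _ * r at this
    exact mul_right_cancel₀ hr0 this
  have hk : k.re = 0 := by
    have := hnorm 1
    rw [h3, Complex.norm_exp] at this
    simpa using this
  refine ⟨k.im, fun t => ?_⟩
  rw [h3]
  congr 1
  apply Complex.ext <;> simp [hk]
  ring

/-! ### Isometries determined by Gram matrices -/

section Gram

variable {T H H' : Type*} [NormedAddCommGroup H] [InnerProductSpace ℂ H] [CompleteSpace H]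
  [NormedAddCommGroup H'] [InnerProductSpace ℂ H']

/-- Two families of vectors with the same Gram matrix, the second of which is total, are related
by an isometry. -/
theorem exists_linearIsometry_of_inner_eq (v : T → H) (v' : T → H')
    (h : ∀ s t, (inner ℂ (v s) (v t) : ℂ) = inner ℂ (v' s) (v' t))
    (hv' : Dense (Submodule.span ℂ (Set.range v') : Set H')) :
    ∃ J : H' →ₗᵢ[ℂ] H, ∀ t, J (v' t) = v t := by
  let f := Finsupp.linearCombination ℂ v
  let e := Finsupp.linearCombination ℂ v'
  have hnorm : ∀ a, ‖f a‖ = ‖e a‖ := fun a => by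
    have : (inner ℂ (f a) (f a) : ℂ) = inner ℂ (e a) (e a) := by
      simp only [f, e, Finsupp.linearCombination_apply, Finsupp.sum_inner, Finsupp.inner_sum,
        inner_smul_left, inner_smul_right, h]
    rw [inner_self_eq_norm_sq_to_K, inner_self_eq_norm_sq_to_K] at this
    exact (pow_left_inj₀ (norm_nonneg _) (norm_nonneg _) two_ne_zero).1 (by exact_mod_cast this)
  have hdense : DenseRange e := by
    have h1 : (LinearMap.range e : Set H') = Submodule.span ℂ (Set.range v') := by
      rw [Finsupp.range_linearCombination]
    rw [DenseRange, ← LinearMap.coe_range, h1]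
    exact hv'
  let J := f.extendOfNorm e
  have hJ : ∀ a, J (e a) = f a := fun a =>
    LinearMap.extendOfNorm_eq hdense ⟨1, fun a => by rw [one_mul, hnorm]⟩ a
  have hJn : ∀ x, ‖J x‖ = ‖x‖ := fun x =>
    congrFun (hdense.equalizer J.continuous.norm continuous_norm
      (funext fun a => by simp only [Function.comp_apply, hJ, hnorm])) x
  refine ⟨⟨J, hJn⟩, fun t => ?_⟩
  have := hJ (Finsupp.single t 1)
  simpa [f, e] using this

end Gram

/-! ### Reducing subspaces -/

section Reducing

variable {S H : Type*} [AddMonoid S] [TopologicalSpace S] [NormedAddCommGroup H]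
  [InnerProductSpace ℂ H] [CompleteSpace H]

/-- The orthogonal projection onto a reducing subspace lies in the commutant, hence is a scalar `c`;
the two cases are `c = 0` and `c ≠ 0`. -/
theorem IsIrred.eq_bot_or_eq_top {V : IsoRep S H} (hV : IsIrred V) (M : Submodule ℂ H)
    (hM : IsClosed (M : Set H)) (h : ∀ s, ∀ x ∈ M, V.op s x ∈ M)
    (h' : ∀ s, ∀ x ∈ M, adjoint (V.op s) x ∈ M) : M = ⊥ ∨ M = ⊤ := by
  have : CompleteSpace M := hM.completeSpace_coe
  have key : ∀ A : H →L[ℂ] H, (∀ x ∈ M, A x ∈ M) → (∀ x ∈ M, adjoint A x ∈ M) →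
      M.starProjection ∘L A = A ∘L M.starProjection := by
    intro A hA hA'
    ext x
    have h1 : A x = A (M.starProjection x) + A (x - M.starProjection x) := by
      rw [← map_add, add_sub_cancel]
    have h2 : A (x - M.starProjection x) ∈ Mᗮ := by
      rw [Submodule.mem_orthogonal]
      intro u hu
      rw [← ContinuousLinearMap.adjoint_inner_left]
      exact (Submodule.mem_orthogonal _ _).1 (Submodule.sub_starProjection_mem_orthogonal x) _
        (hA' u hu)
    rw [ContinuousLinearMap.comp_apply, ContinuousLinearMap.comp_apply, h1, map_add,
      Submodule.starProjection_eq_self_iff.2 (hA _ (Submodule.starProjection_apply_mem _ _)),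
      (Submodule.starProjection_apply_eq_zero_iff M).2 h2, add_zero]
  obtain ⟨c, hc⟩ := hV.2 M.starProjection fun s =>
    ⟨key _ (h s) (h' s), key _ (h' s) (by rw [ContinuousLinearMap.adjoint_adjoint]; exact h s)⟩
  by_cases h0 : c = 0
  · left
    rw [Submodule.eq_bot_iff]
    intro x hx
    rw [← Submodule.starProjection_eq_self_iff.2 hx, hc, h0, zero_smul]
    rfl
  · right
    rw [Submodule.eq_top_iff']
    intro x
    have h1 : c • x ∈ M := by
      have := Submodule.starProjection_apply_mem M x
      rw [hc] at this
      exact this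
    simpa [smul_smul, inv_mul_cancel₀ h0] using M.smul_mem c⁻¹ h1

/-- An isometry into the space of an irreducible representation that intertwines the operators and
their adjoints is onto. -/
theorem IsIrred.surjective_of_intertwining {H' : Type*} [NormedAddCommGroup H']
    [InnerProductSpace ℂ H'] [CompleteSpace H'] [Nontrivial H'] {V : IsoRep S H} (hV : IsIrred V)
    {V' : IsoRep S H'} (J : H' →ₗᵢ[ℂ] H) (h : ∀ s x, J (V'.op s x) = V.op s (J x))
    (h' : ∀ s x, J (adjoint (V'.op s) x) = adjoint (V.op s) (J x)) : Function.Surjective J := by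
  have := hV.eq_bot_or_eq_top (LinearMap.range J.toLinearMap)
    J.isometry.isClosedEmbedding.isClosed_range
    (by rintro s _ ⟨x, rfl⟩; exact ⟨V'.op s x, h s x⟩)
    (by rintro s _ ⟨x, rfl⟩; exact ⟨adjoint (V'.op s) x, h' s x⟩)
  rcases this with h0 | h0
  · obtain ⟨x, hx⟩ := exists_ne (0 : H')
    refine absurd (J.injective ?_) hx
    rw [map_zero]
    exact (Submodule.eq_bot_iff _).1 h0 _ ⟨x, rfl⟩
  · exact LinearMap.range_eq_top.1 h0

end Reducing

/-! ### Vacuum vectors of doubly commuting representations -/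

section Vacuum

variable {d : ℕ} {H : Type*} [NormedAddCommGroup H] [InnerProductSpace ℂ H]
  (V : IsoRep (Fin d → ℝ≥0) H)

theorem IsoRep.op_comm (s t : Fin d → ℝ≥0) (x : H) : V.op s (V.op t x) = V.op t (V.op s x) := by
  rw [← ContinuousLinearMap.comp_apply, ← ContinuousLinearMap.comp_apply, ← V.op_add, add_comm,
    V.op_add]

/-- A property of parameters that is additive holds as soon as it holds on the coordinate axes. -/
theorem forall_of_single {p : (Fin d → ℝ≥0) → Prop} (h0 : p 0)
    (hadd : ∀ s t, p s → p t → p (s + t)) (t : Fin d → ℝ≥0)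
    (hs : ∀ i, p (Pi.single i (t i))) : p t := by
  rw [← Finset.univ_sum_single t]
  exact Finset.sum_induction _ p hadd h0 fun i _ => hs i

theorem IsoRep.commute_of_single {T : H → H} {t : Fin d → ℝ≥0}
    (h : ∀ i x, T (V.op (Pi.single i (t i)) x) = V.op (Pi.single i (t i)) (T x)) (x : H) :
    T (V.op t x) = V.op t (T x) := by
  refine forall_of_single (p := fun t => ∀ x, T (V.op t x) = V.op t (T x)) ?_ ?_ t h x
  · intro x
    simp [V.op_zero]
  · intro s t hs ht x
    rw [V.op_add, ContinuousLinearMap.comp_apply, ContinuousLinearMap.comp_apply, hs, ht]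

variable {V} [CompleteSpace H]

/-- Double commutation is assumed on the axes only. It extends to disjoint supports by splitting `s`
into its components and then, after passing to adjoints, splitting `t`. -/
theorem DoublyCommuting.op_adjoint_comm (hV : DoublyCommuting V) {s t : Fin d → ℝ≥0}
    (h : ∀ i, s i = 0 ∨ t i = 0) (x : H) :
    V.op s (adjoint (V.op t) x) = adjoint (V.op t) (V.op s x) := by
  refine (V.commute_of_single (T := adjoint (V.op t)) (fun i x => ?_) x).symm
  rcases h i with h0 | h0
  · rw [h0, Pi.single_zero, V.op_zero]; rfl
  · refine ext_inner_right ℂ fun y => ?_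
    have := V.commute_of_single (T := adjoint (V.op (Pi.single i (s i)))) (t := t) (fun j z => ?_) y
    · rw [ContinuousLinearMap.adjoint_inner_left, ← ContinuousLinearMap.adjoint_inner_right,
        this, ← ContinuousLinearMap.adjoint_inner_left, ContinuousLinearMap.adjoint_inner_right]
    · by_cases hij : j = i
      · subst hij
        rw [h0, Pi.single_zero, V.op_zero]; rfl
      · exact (congrArg (fun A => A z) (hV j i hij (t j) (s i))).symm

/-- The common part `s ⊓ t` cancels because `V` is isometric; the remainders `s - t` and `t - s`
have disjoint supports, so their operators may be exchanged. -/
theorem DoublyCommuting.adjoint_op_op (hV : DoublyCommuting V) (s t : Fin d → ℝ≥0) (x : H) :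
    adjoint (V.op s) (V.op t x) = V.op (t - s) (adjoint (V.op (s - t)) x) := by
  have hs : s = s ⊓ t + (s - t) := by
    ext i
    rcases le_total (s i) (t i) with h | h <;> simp [h, tsub_eq_zero_of_le]
  have ht : t = s ⊓ t + (t - s) := by
    ext i
    rcases le_total (s i) (t i) with h | h <;> simp [h, tsub_eq_zero_of_le]
  have h1 : adjoint (V.op s) (V.op t x) =
      adjoint (V.op (s - t)) (adjoint (V.op (s ⊓ t)) (V.op (s ⊓ t) (V.op (t - s) x))) := by
    have h2 : V.op t = V.op (s ⊓ t) ∘L V.op (t - s) := by rw [← V.op_add, ← ht]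
    have h3 : V.op s = V.op (s ⊓ t) ∘L V.op (s - t) := by rw [← V.op_add, ← hs]
    rw [h2, h3, ContinuousLinearMap.adjoint_comp]
    rfl
  rw [h1, V.adjoint_op_op, hV.op_adjoint_comm]
  intro i
  rcases le_total (s i) (t i) with h | h <;> simp [h, tsub_eq_zero_of_le]

/-- The eigenvalue `e^{-i ∑_{j ∉ A} λ_j t_j} e^{-∑_{k ∈ A} t_k}`. -/
def vacuumCoeff (p : Param d) (t : Fin d → ℝ≥0) : ℂ :=
  (starRingEnd ℂ) (phase p t) * (Real.exp (-∑ k : {k : Fin d // k ∈ p.1}, (t k : ℝ)) : ℝ)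

theorem vacuumCoeff_zero (p : Param d) : vacuumCoeff p 0 = 1 := by
  simp [vacuumCoeff, phase_zero]

theorem vacuumCoeff_add (p : Param d) (s t : Fin d → ℝ≥0) :
    vacuumCoeff p (s + t) = vacuumCoeff p s * vacuumCoeff p t := by
  simp only [vacuumCoeff, phase_add, Pi.add_apply, NNReal.coe_add, Finset.sum_add_distrib, neg_add,
    Real.exp_add, map_mul, Complex.ofReal_mul]
  ring

variable (V)

/-- Joint eigenvectors of the adjoints `V_t^*`, with the eigenvalues that occur in the model. -/
def IsVacuum (p : Param d) (w : H) : Prop :=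
  ∀ t, adjoint (V.op t) w = vacuumCoeff p t • w

variable {V}

theorem IsVacuum.adjoint_op_op (hV : DoublyCommuting V) {p : Param d} {w : H}
    (hw : IsVacuum V p w) (s t : Fin d → ℝ≥0) :
    adjoint (V.op s) (V.op t w) = vacuumCoeff p (s - t) • V.op (t - s) w := by
  rw [hV.adjoint_op_op, hw, map_smul]

/-- With `w = w'` this is the Gram matrix that determines the orbit up to unitary equivalence; for
orthogonal `w` and `w'` it makes their orbits orthogonal. -/
theorem IsVacuum.inner_op (hV : DoublyCommuting V) {p : Param d} {w w' : H}
    (hw : IsVacuum V p w) (hw' : IsVacuum V p w') (s t : Fin d → ℝ≥0) :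
    (inner ℂ (V.op s w) (V.op t w') : ℂ) =
      vacuumCoeff p (s - t) * (starRingEnd ℂ) (vacuumCoeff p (t - s)) * inner ℂ w w' := by
  rw [← ContinuousLinearMap.adjoint_inner_right, hw'.adjoint_op_op hV, inner_smul_right,
    ← ContinuousLinearMap.adjoint_inner_left, hw, inner_smul_left, mul_assoc]

/-- A unit vacuum vector spans a copy of any representation with a cyclic unit vacuum vector. -/
theorem IsVacuum.exists_intertwining {H' : Type*} [NormedAddCommGroup H'] [InnerProductSpace ℂ H']
    [CompleteSpace H'] {V' : IsoRep (Fin d → ℝ≥0) H'} {p : Param d} {w : H} {w' : H'}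
    (hV : DoublyCommuting V) (hw : IsVacuum V p w) (hV' : DoublyCommuting V')
    (hw' : IsVacuum V' p w') (hn : ‖w‖ = ‖w'‖)
    (hd : Dense (Submodule.span ℂ (Set.range fun t => V'.op t w') : Set H')) :
    ∃ J : H' →ₗᵢ[ℂ] H, J w' = w ∧ (∀ t x, J (V'.op t x) = V.op t (J x)) ∧
      ∀ t x, J (adjoint (V'.op t) x) = adjoint (V.op t) (J x) := by
  obtain ⟨J, hJ⟩ := exists_linearIsometry_of_inner_eq (fun t => V.op t w) (fun t => V'.op t w')
    (fun s t => by
      rw [hw.inner_op hV hw, hw'.inner_op hV' hw', inner_self_eq_norm_sq_to_K,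
        inner_self_eq_norm_sq_to_K, hn]) hd
  have key : ∀ A B : H' →L[ℂ] H, (∀ t, A (V'.op t w') = B (V'.op t w')) → A = B := fun A B h =>
    ContinuousLinearMap.ext_on hd (by rintro _ ⟨t, rfl⟩; exact h t)
  refine ⟨J, ?_, fun t x => ?_, fun t x => ?_⟩
  · simpa [V.op_zero, V'.op_zero] using hJ 0
  · refine congrArg (fun A => A x) (key (J.toContinuousLinearMap ∘L V'.op t)
      (V.op t ∘L J.toContinuousLinearMap) fun s => ?_)
    change J (V'.op t (V'.op s w')) = V.op t (J (V'.op s w'))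
    rw [hJ, ← ContinuousLinearMap.comp_apply, ← V'.op_add, hJ, V.op_add]
    rfl
  · refine congrArg (fun A => A x) (key (J.toContinuousLinearMap ∘L adjoint (V'.op t))
      (adjoint (V.op t) ∘L J.toContinuousLinearMap) fun s => ?_)
    change J (adjoint (V'.op t) (V'.op s w')) = adjoint (V.op t) (J (V'.op s w'))
    rw [hJ, hw'.adjoint_op_op hV', hw.adjoint_op_op hV, map_smul, hJ]

/-- A doubly commuting representation with a cyclic vacuum vector is irreducible. -/
theorem IsVacuum.isIrred {p : Param d} {w : H} (hw : IsVacuum V p w) (hw0 : w ≠ 0)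
    (hd : Dense (Submodule.span ℂ (Set.range fun t => V.op t w) : Set H)) : IsIrred V := by
  refine ⟨⟨w, 0, hw0⟩, fun T hT => ?_⟩
  have hTw : IsVacuum V p (T w) := fun t => by
    have := congrArg (fun A => A w) (hT t).2
    simp only [ContinuousLinearMap.comp_apply] at this
    rw [← this, hw, map_smul]
  set c : ℂ := inner ℂ w (T w) / inner ℂ w w with hc
  have h0 : T w = c • w := by
    -- By the choice of `c` the difference is orthogonal to `w`; being a joint eigenvector of the
    -- adjoints, it is then orthogonal to the whole orbit of `w`.
    have horth : ∀ x, inner ℂ (T w - c • w) x = (0 : ℂ) := by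
      intro x
      refine congrArg (fun A : H →L[ℂ] ℂ => A x) (ContinuousLinearMap.ext_on
        (f := innerSL ℂ (T w - c • w)) (g := 0) hd ?_)
      rintro _ ⟨t, rfl⟩
      simp only [innerSL_apply_apply, zero_apply]
      rw [← ContinuousLinearMap.adjoint_inner_left, map_sub, map_smul, hTw, hw, smul_comm c,
        ← smul_sub, inner_smul_left, ← inner_conj_symm, inner_sub_right, inner_smul_right, hc,
        div_mul_cancel₀ _ (inner_self_ne_zero.2 hw0), sub_self, map_zero, mul_zero]
    exact sub_eq_zero.1 (inner_self_eq_zero.1 (horth _))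
  refine ⟨c, ContinuousLinearMap.ext_on hd ?_⟩
  rintro _ ⟨t, rfl⟩
  have := congrArg (fun A => A w) (hT t).1
  simp only [ContinuousLinearMap.comp_apply] at this
  rw [this, h0, map_smul]
  rfl

end Vacuum

/-! ### Restrictions of representations -/

section Restrict

variable {S H : Type*} [AddMonoid S] [TopologicalSpace S] [NormedAddCommGroup H]
  [InnerProductSpace ℂ H]

/-- The restriction of a representation to an invariant subspace. -/
def IsoRep.restrict (V : IsoRep S H) (F : Submodule ℂ H) (h : ∀ s, ∀ x ∈ F, V.op s x ∈ F) :
    IsoRep S F where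
  op s := (V.op s ∘L F.subtypeL).codRestrict F fun x => h s x x.2
  norm_op s x := V.norm_op s x
  op_zero := by
    ext x
    simp [V.op_zero]
  op_add s t := by
    ext x
    simp only [V.op_add]
    rfl
  strongly_continuous x := by
    rw [continuous_induced_rng]
    exact V.strongly_continuous x

theorem IsoRep.adjoint_restrict [CompleteSpace H] (V : IsoRep S H) (F : Submodule ℂ H)
    [CompleteSpace F] (h : ∀ s, ∀ x ∈ F, V.op s x ∈ F) (h' : ∀ s, ∀ x ∈ F, adjoint (V.op s) x ∈ F)
    (s : S) (x : F) : (adjoint ((V.restrict F h).op s) x : H) = adjoint (V.op s) x := by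
  have : adjoint ((V.restrict F h).op s) =
      (adjoint (V.op s) ∘L F.subtypeL).codRestrict F fun x => h' s x x.2 := by
    symm
    rw [ContinuousLinearMap.eq_adjoint_iff]
    intro x y
    exact ContinuousLinearMap.adjoint_inner_left (V.op s) (y : H) (x : H)
  rw [this]
  rfl

/-- The restriction of a representation of `ℝ₊^d` to a coordinate axis. -/
def IsoRep.coord {d : ℕ} (V : IsoRep (Fin d → ℝ≥0) H) (i : Fin d) : IsoRep ℝ≥0 H where
  op t := V.op (Pi.single i t)
  norm_op t x := V.norm_op _ x
  op_zero := by rw [Pi.single_zero, V.op_zero]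
  op_add s t := by rw [Pi.single_add, V.op_add]
  strongly_continuous x := (V.strongly_continuous x).comp (continuous_single (A := fun _ => ℝ≥0) i)

end Restrict

/-! ### Values of the characters on the coordinate axes -/

section Single

variable {d : ℕ} (p : Param d)

theorem phase_single_of_mem {i : Fin d} (hi : i ∈ p.1) (t : ℝ≥0) :
    phase p (Pi.single i t) = 1 := by
  have : ∀ j : {j : Fin d // j ∉ p.1}, (Pi.single i t : Fin d → ℝ≥0) j = 0 := fun j =>
    Pi.single_eq_of_ne (fun h : (j : Fin d) = i => j.2 (h ▸ hi)) _
  simp [phase, this]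

theorem phase_single_of_notMem {i : Fin d} (hi : i ∉ p.1) (t : ℝ≥0) :
    phase p (Pi.single i t) = Complex.exp (Complex.I * ((t * p.2 ⟨i, hi⟩ : ℝ) : ℂ)) := by
  rw [phase, Finset.sum_eq_single (⟨i, hi⟩ : {j : Fin d // j ∉ p.1})]
  · simp
  · intro j _ hj
    rw [Pi.single_eq_of_ne (fun h => hj (Subtype.ext h))]
    simp
  · simp

theorem vacuumCoeff_single_of_mem {i : Fin d} (hi : i ∈ p.1) (t : ℝ≥0) :
    vacuumCoeff p (Pi.single i t) = (Real.exp (-t) : ℝ) := by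
  rw [vacuumCoeff, phase_single_of_mem p hi, Finset.sum_eq_single (⟨i, hi⟩ : {j // j ∈ p.1})]
  · simp
  · intro j _ hj
    rw [Pi.single_eq_of_ne (fun h => hj (Subtype.ext h))]
    simp
  · simp

theorem vacuumCoeff_single_of_notMem {i : Fin d} (hi : i ∉ p.1) (t : ℝ≥0) :
    vacuumCoeff p (Pi.single i t) = (starRingEnd ℂ) (phase p (Pi.single i t)) := by
  have : ∀ j : {j : Fin d // j ∈ p.1}, (Pi.single i t : Fin d → ℝ≥0) j = 0 := fun j =>
    Pi.single_eq_of_ne (fun h : (j : Fin d) = i => hi (h ▸ j.2)) _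
  simp [vacuumCoeff, this]

end Single

/-! ### Vacuum vectors in irreducible doubly commuting representations -/

section Irreducible

variable {d : ℕ} {H : Type*} [NormedAddCommGroup H] [InnerProductSpace ℂ H] [CompleteSpace H]
  {V : IsoRep (Fin d → ℝ≥0) H}

theorem adjoint_op_add {S : Type*} [AddCommMonoid S] [TopologicalSpace S] (V : IsoRep S H)
    (s t : S) (x : H) : adjoint (V.op (s + t)) x = adjoint (V.op s) (adjoint (V.op t) x) := by
  rw [add_comm, V.op_add, ContinuousLinearMap.adjoint_comp]
  rfl

theorem adjoint_op_zero {S : Type*} [AddMonoid S] [TopologicalSpace S] (V : IsoRep S H) (x : H) :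
    adjoint (V.op 0) x = x := by
  rw [V.op_zero, show adjoint (1 : H →L[ℂ] H) = 1 from ContinuousLinearMap.adjoint_id]
  rfl

/-- A coordinate semigroup of an irreducible doubly commuting representation is unitary or
completely non-unitary. -/
theorem IsIrred.unitary_or_pure (hV : IsIrred V) (hD : DoublyCommuting V) (i : Fin d) :
    (∀ (t : ℝ≥0) x, ‖adjoint (V.op (Pi.single i t)) x‖ = ‖x‖) ∨
      ∀ x, (∀ t : ℝ≥0, ‖adjoint (V.op (Pi.single i t)) x‖ = ‖x‖) → x = 0 := by
  -- This is the unitary part in the Wold decomposition of the `i`-th coordinate semigroup.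
  let U : Submodule ℂ H := ⨅ t : ℝ≥0, LinearMap.range (V.op (Pi.single i t) : H →ₗ[ℂ] H)
  have hU : ∀ x, x ∈ U ↔ ∀ t : ℝ≥0, ∃ y, V.op (Pi.single i t) y = x := fun x => by
    simp [U, Submodule.mem_iInf]
  have hclosed : IsClosed (U : Set H) := by
    rw [Submodule.coe_iInf]
    refine isClosed_iInter fun t => ?_
    exact (⟨(V.op (Pi.single i t) : H →ₗ[ℂ] H), V.norm_op _⟩ :
      H →ₗᵢ[ℂ] H).isometry.isClosedEmbedding.isClosed_range
  have hinv : ∀ s, ∀ x ∈ U, V.op s x ∈ U := fun s x hx => by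
    rw [hU] at hx ⊢
    intro t
    obtain ⟨y, rfl⟩ := hx t
    exact ⟨V.op s y, V.op_comm _ _ _⟩
  have hinv' : ∀ s, ∀ x ∈ U, adjoint (V.op s) x ∈ U := fun s => by
    refine forall_of_single (p := fun s => ∀ x ∈ U, adjoint (V.op s) x ∈ U) ?_ ?_ s ?_
    · intro x hx
      rwa [adjoint_op_zero]
    · intro s t hs ht x hx
      rw [adjoint_op_add]
      exact hs _ (ht x hx)
    · intro j x hx
      rw [hU] at hx ⊢
      intro t
      by_cases hij : i = j
      · subst hij
        -- The adjoint removes `s i`, so membership is used at `s i + t` to keep a factor for `t`.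
        obtain ⟨y, rfl⟩ := hx (s i + t)
        refine ⟨y, ?_⟩
        rw [Pi.single_add, V.op_add, ContinuousLinearMap.comp_apply, V.adjoint_op_op]
      · obtain ⟨y, rfl⟩ := hx t
        exact ⟨_, congrArg (fun A => A y) (hD i j hij t (s j))⟩
  rcases hV.eq_bot_or_eq_top U hclosed hinv hinv' with h | h
  · right
    intro x hx
    rw [← Submodule.mem_bot ℂ, ← h, hU]
    exact fun t => ⟨_, V.op_adjoint_op_of_norm_eq (hx t)⟩
  · left
    intro t x
    obtain ⟨y, rfl⟩ := (hU x).1 (h ▸ Submodule.mem_top) t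
    rw [V.adjoint_op_op, V.norm_op]

/-- A unitary coordinate semigroup of an irreducible representation is a character. -/
theorem IsIrred.exists_character (hV : IsIrred V) {i : Fin d}
    (hi : ∀ (t : ℝ≥0) x, ‖adjoint (V.op (Pi.single i t)) x‖ = ‖x‖) :
    ∃ l : ℝ, ∀ t : ℝ≥0, V.op (Pi.single i t) =
      Complex.exp (Complex.I * ((t * l : ℝ) : ℂ)) • (1 : H →L[ℂ] H) := by
  have hc : ∀ t : ℝ≥0, ∃ c : ℂ, V.op (Pi.single i t) = c • (1 : H →L[ℂ] H) := by
    refine fun t => hV.2 _ fun s => ⟨?_, ?_⟩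
    · ext x
      exact V.op_comm _ _ _
    · ext x
      -- The adjoints commute among themselves and `V_{te_i}` is an isometry; since it is also onto,
      -- applying it to this identity yields the commutation.
      have h1 : adjoint (V.op s) x = adjoint (V.op (Pi.single i t)) (adjoint (V.op s)
          (V.op (Pi.single i t) x)) := by
        rw [← adjoint_op_add, add_comm, adjoint_op_add, V.adjoint_op_op]
      rw [ContinuousLinearMap.comp_apply, h1, V.op_adjoint_op_of_norm_eq (hi t _)]
      rfl
  choose c hc using hc
  have happ : ∀ t x, V.op (Pi.single i t) x = c t • x := fun t x => by rw [hc]; rfl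
  have := hV.1
  obtain ⟨x, hx⟩ := exists_ne (0 : H)
  have hxx : (inner ℂ x x : ℂ) ≠ 0 := inner_self_ne_zero.2 hx
  have hsmul : ∀ a b : ℂ, a • x = b • x → a = b := fun a b h => smul_left_injective ℂ hx h
  obtain ⟨l, hl⟩ := exists_exp_of_character c
    (by
      -- Continuity of `c` is read off from a matrix coefficient.
      have h1 : c = fun t => inner ℂ x (V.op (Pi.single i t) x) / inner ℂ x x := by
        ext t
        rw [happ, inner_smul_right, mul_div_cancel_right₀ _ hxx]
      rw [h1]
      have h2 : Continuous fun t => V.op (Pi.single i t) x := (V.coord i).strongly_continuous x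
      exact Continuous.div_const (by fun_prop) _)
    (hsmul _ _ (by rw [← happ, Pi.single_zero, V.op_zero, one_smul]; rfl))
    (fun s t => hsmul _ _ (by
      rw [← happ, Pi.single_add, V.op_add, ContinuousLinearMap.comp_apply, happ, happ, smul_smul]))
    (fun t => by
      have h1 := V.norm_op (Pi.single i t) x
      rw [happ, norm_smul] at h1
      exact mul_right_cancel₀ (norm_ne_zero_iff.2 hx) (h1.trans (one_mul _).symm))
  exact ⟨l, fun t => by rw [hc, hl]⟩

variable (V) in
/-- The joint eigenvectors, with eigenvalues `e^{-t}`, of the adjoint coordinate semigroups with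
index in `B`. -/
def jointEigenspace (B : Finset (Fin d)) : Submodule ℂ H :=
  ⨅ i ∈ B, ⨅ t : ℝ≥0, LinearMap.ker
    ((adjoint (V.op (Pi.single i t)) - ((Real.exp (-t) : ℝ) : ℂ) • (1 : H →L[ℂ] H) :
      H →L[ℂ] H) : H →ₗ[ℂ] H)

theorem mem_jointEigenspace {B : Finset (Fin d)} {x : H} : x ∈ jointEigenspace V B ↔
    ∀ i ∈ B, ∀ t : ℝ≥0, adjoint (V.op (Pi.single i t)) x = ((Real.exp (-t) : ℝ) : ℂ) • x := by
  simp [jointEigenspace, Submodule.mem_iInf, sub_eq_zero]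

theorem isClosed_jointEigenspace (B : Finset (Fin d)) :
    IsClosed (jointEigenspace V B : Set H) := by
  simp only [jointEigenspace, Submodule.coe_iInf]
  exact isClosed_iInter fun i => isClosed_iInter fun _ => isClosed_iInter fun t =>
    ContinuousLinearMap.isClosed_ker (adjoint (V.op (Pi.single i t)) -
      ((Real.exp (-t) : ℝ) : ℂ) • (1 : H →L[ℂ] H))

/-- For `j ∉ B` the joint eigenspace of `B` is closed and reduces the `j`-th semigroup. The
restriction either has an eigenvector or is unitary, and `hB` rules out the latter on a nonzero
space. -/
theorem DoublyCommuting.exists_joint_eigenvector [Nontrivial H] (hD : DoublyCommuting V)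
    (B : Finset (Fin d)) (hB : ∀ i ∈ B, ∀ x,
      (∀ t : ℝ≥0, ‖adjoint (V.op (Pi.single i t)) x‖ = ‖x‖) → x = 0) :
    ∃ w ∈ jointEigenspace V B, w ≠ 0 := by
  induction B using Finset.induction_on with
  | empty =>
    obtain ⟨x, hx⟩ := exists_ne (0 : H)
    exact ⟨x, by simp [mem_jointEigenspace], hx⟩
  | insert j B hj ih =>
    obtain ⟨w, hw, hw0⟩ := ih fun i hi => hB i (Finset.mem_insert_of_mem hi)
    have hF : CompleteSpace (jointEigenspace V B) :=
      (isClosed_jointEigenspace B).completeSpace_coe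
    have hne : ∀ i ∈ B, j ≠ i := fun i hi h => hj (h ▸ hi)
    have h1 : ∀ s : ℝ≥0, ∀ x ∈ jointEigenspace V B, (V.coord j).op s x ∈ jointEigenspace V B := by
      intro s x hx
      rw [mem_jointEigenspace] at hx ⊢
      intro i hi t
      have := congrArg (fun A => A x) (hD j i (hne i hi) s t)
      simp only [ContinuousLinearMap.comp_apply] at this
      rw [IsoRep.coord, ← this, hx i hi, map_smul]
    have h2 : ∀ s : ℝ≥0, ∀ x ∈ jointEigenspace V B,
        adjoint ((V.coord j).op s) x ∈ jointEigenspace V B := by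
      intro s x hx
      rw [mem_jointEigenspace] at hx ⊢
      intro i hi t
      rw [IsoRep.coord, ← adjoint_op_add, add_comm, adjoint_op_add, hx i hi, map_smul]
    rcases ((V.coord j).restrict _ h1).exists_eigenvector_or_unitary with ⟨v, hv0, hv⟩ | h
    · refine ⟨v, ?_, fun h => hv0 (Subtype.ext h)⟩
      rw [mem_jointEigenspace]
      intro i hi t
      rcases Finset.mem_insert.1 hi with rfl | hi
      · have := congrArg Subtype.val (hv t)
        rw [IsoRep.adjoint_restrict _ _ h1 h2] at this
        exact_mod_cast this
      · exact mem_jointEigenspace.1 v.2 i hi t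
    · refine absurd (hB j (Finset.mem_insert_self _ _) w fun t => ?_) hw0
      have := h t ⟨w, hw⟩
      rw [Submodule.coe_norm, Submodule.coe_norm, IsoRep.adjoint_restrict _ _ h1 h2] at this
      exact this

theorem IsIrred.exists_isVacuum (hV : IsIrred V) (hD : DoublyCommuting V) :
    ∃ (p : Param d) (w : H), IsVacuum V p w ∧ w ≠ 0 := by
  classical
  have := hV.1
  -- `A` collects the axes that are not unitary; by the dichotomy these are completely non-unitary,
  -- and all others act by characters.
  let A : Finset (Fin d) := Finset.univ.filter fun i =>
    ¬ ∀ (t : ℝ≥0) x, ‖adjoint (V.op (Pi.single i t)) x‖ = ‖x‖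
  have hA : ∀ i, i ∉ A → ∃ l : ℝ, ∀ t : ℝ≥0, V.op (Pi.single i t) =
      Complex.exp (Complex.I * ((t * l : ℝ) : ℂ)) • (1 : H →L[ℂ] H) := fun i hi =>
    hV.exists_character (by simpa [A] using hi)
  obtain ⟨w, hw, hw0⟩ := hD.exists_joint_eigenvector A fun i hi =>
    (hV.unitary_or_pure hD i).resolve_left (Finset.mem_filter.1 hi).2
  choose l hl using hA
  refine ⟨⟨A, fun j => l j j.2⟩, w, fun t => ?_, hw0⟩
  refine forall_of_single
    (p := fun t => adjoint (V.op t) w = vacuumCoeff ⟨A, fun j => l j j.2⟩ t • w) ?_ ?_ t ?_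
  · rw [adjoint_op_zero, vacuumCoeff_zero, one_smul]
  · intro s t hs ht
    rw [adjoint_op_add, ht, map_smul, hs, smul_smul, mul_comm, vacuumCoeff_add]
  · intro i
    by_cases hi : i ∈ A
    · rw [vacuumCoeff_single_of_mem _ hi, mem_jointEigenspace.1 hw i hi]
    · rw [vacuumCoeff_single_of_notMem _ hi, phase_single_of_notMem _ hi, hl i hi, map_smulₛₗ,
        show adjoint (1 : H →L[ℂ] H) = 1 from ContinuousLinearMap.adjoint_id]
      rfl

end Irreducible

/-! ### Shifts on `L²(ℝ₊^ι)` and their adjoints -/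

section ShiftAdjoint

variable {ι : Type*} [Fintype ι]

theorem extendZero_ae {f : L2Cone ι} {h : (ι → ℝ) → ℂ} (hf : f =ᵐ[coneMeasure ι] h) :
    extendZero f =ᵐ[volume] (Set.Ici (0 : ι → ℝ)).indicator h :=
  (extendZero_coeFn f).trans ((ae_eq_restrict_iff_indicator_ae_eq measurableSet_Ici).1 hf)

theorem translate_ae (a : ι → ℝ) {g : Lp ℂ 2 (volume : Measure (ι → ℝ))} {h : (ι → ℝ) → ℂ}
    (hg : g =ᵐ[volume] h) : translate a g =ᵐ[volume] fun x => h (x - a) :=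
  (translate_coeFn a g).trans
    ((measurePreserving_sub_right volume a).quasiMeasurePreserving.ae_eq_comp hg)

/-- Restriction `L²(ℝ^ι) → L²(ℝ₊^ι)`. -/
abbrev restrictCone : Lp ℂ 2 (volume : Measure (ι → ℝ)) →L[ℂ] L2Cone ι :=
  LpToLpRestrictCLM (ι → ℝ) ℂ ℂ volume 2 (Set.Ici 0)

theorem restrictCone_ae {g : Lp ℂ 2 (volume : Measure (ι → ℝ))} {h : (ι → ℝ) → ℂ}
    (hg : g =ᵐ[volume] h) : restrictCone g =ᵐ[coneMeasure ι] h :=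
  (LpToLpRestrictCLM_coeFn ℂ _ g).trans (ae_restrict_of_ae hg)

theorem inner_restrictCone (g : Lp ℂ 2 (volume : Measure (ι → ℝ))) (f : L2Cone ι) :
    (inner ℂ (restrictCone g) f : ℂ) = inner ℂ g (extendZero f) := by
  rw [L2.inner_def, L2.inner_def, ← integral_indicator measurableSet_Ici]
  refine integral_congr_ae ?_
  have h1 := (ae_eq_restrict_iff_indicator_ae_eq measurableSet_Ici).1
    (LpToLpRestrictCLM_coeFn ℂ (Set.Ici (0 : ι → ℝ)) g)
  filter_upwards [h1, extendZero_coeFn f] with x hx hx'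
  rw [hx']
  by_cases h : x ∈ Set.Ici (0 : ι → ℝ)
  · rw [Set.indicator_of_mem h, Set.indicator_of_mem h] at hx
    rw [Set.indicator_of_mem h, Set.indicator_of_mem h, hx]
  · rw [Set.indicator_of_notMem h, Set.indicator_of_notMem h, inner_zero_right]

theorem translate_neg_translate (a : ι → ℝ) (g : Lp ℂ 2 (volume : Measure (ι → ℝ))) :
    translate (-a) (translate a g) = g := by
  apply Lp.ext
  refine (translate_ae (-a) (translate_coeFn a g)).trans (.of_forall fun x => ?_)
  simp

/-- Restriction to the cone is adjoint to extension by zero, and translation by `-τ` is adjoint to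
translation by `τ`. -/
theorem adjoint_shift (τ : ι → ℝ≥0) (f : L2Cone ι) :
    adjoint (shift τ) f = restrictCone (translate (-fun k => (τ k : ℝ)) (extendZero f)) := by
  refine ext_inner_right ℂ fun g => ?_
  rw [ContinuousLinearMap.adjoint_inner_left, inner_restrictCone,
    ← (translate fun k => (τ k : ℝ)).inner_map_map (translate _ _)]
  have := translate_neg_translate (-fun k => (τ k : ℝ)) (extendZero f)
  rw [neg_neg] at this
  rw [this, ← extendZero_shift, extendZero.inner_map_map]

theorem shift_ae (τ : ι → ℝ≥0) {f : L2Cone ι} {h : (ι → ℝ) → ℂ} (hf : f =ᵐ[coneMeasure ι] h) :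
    shift τ f =ᵐ[coneMeasure ι]
      fun x => (Set.Ici (0 : ι → ℝ)).indicator h (x - fun k => (τ k : ℝ)) :=
  restrictCone_ae (translate_ae _ (extendZero_ae hf))

theorem adjoint_shift_ae (τ : ι → ℝ≥0) {f : L2Cone ι} {h : (ι → ℝ) → ℂ}
    (hf : f =ᵐ[coneMeasure ι] h) : adjoint (shift τ) f =ᵐ[coneMeasure ι]
      fun x => (Set.Ici (0 : ι → ℝ)).indicator h (x + fun k => (τ k : ℝ)) := by
  rw [adjoint_shift]
  simpa only [sub_neg_eq_add] using
    restrictCone_ae (translate_ae (-fun k => (τ k : ℝ)) (extendZero_ae hf))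

/-- Both sides are `f(x - σ + τ)` with different cut-offs: `x - σ ≥ 0` on the left, `x - σ + τ ≥ 0`
on the right. For `x ≥ 0` these agree when the supports of `σ` and `τ` are disjoint. -/
theorem shift_adjoint_shift_comm {σ τ : ι → ℝ≥0} (h : ∀ i, σ i = 0 ∨ τ i = 0) (f : L2Cone ι) :
    shift σ (adjoint (shift τ) f) = adjoint (shift τ) (shift σ f) := by
  apply Lp.ext
  refine (shift_ae σ (adjoint_shift_ae τ (Filter.EventuallyEq.refl _ f))).trans
    (Filter.EventuallyEq.trans ?_
      (adjoint_shift_ae τ (shift_ae σ (Filter.EventuallyEq.refl _ f))).symm)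
  filter_upwards [ae_restrict_mem measurableSet_Ici] with x hx
  have hx0 : ∀ k, 0 ≤ x k := hx
  have h1 : (x + fun k => (τ k : ℝ)) ∈ Set.Ici (0 : ι → ℝ) :=
    fun k => add_nonneg (hx0 k) (τ k).2
  have h2 : (x - fun k => (σ k : ℝ)) + (fun k => (τ k : ℝ)) =
      (x + fun k => (τ k : ℝ)) - fun k => (σ k : ℝ) := by abel
  rw [Set.indicator_of_mem h1]
  by_cases h3 : (x - fun k => (σ k : ℝ)) ∈ Set.Ici (0 : ι → ℝ)
  · rw [Set.indicator_of_mem h3, h2]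
  · rw [Set.indicator_of_notMem h3, Set.indicator_of_notMem]
    intro h4
    refine h3 fun k => ?_
    rcases h k with h0 | h0
    · simpa [h0] using hx0 k
    · simpa [h0] using h4 k

end ShiftAdjoint

/-! ### The exponential vector -/

section ExpVector

variable (ι : Type*) [Fintype ι]

/-- The function `x ↦ e^{-∑ x_k}`. -/
def expFun (x : ι → ℝ) : ℂ := (Real.exp (-∑ k, x k) : ℝ)

theorem continuous_expFun : Continuous (expFun ι) := by
  unfold expFun
  fun_prop

theorem memLp_expFun : MemLp (expFun ι) 2 (coneMeasure ι) := by
  rw [memLp_two_iff_integrable_sq_norm (continuous_expFun ι).aestronglyMeasurable]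
  have h1 : coneMeasure ι = Measure.pi fun _ : ι => (volume : Measure ℝ).restrict (Set.Ici 0) := by
    rw [coneMeasure, ← Set.pi_univ_Ici, volume_pi, Measure.restrict_pi_pi]
    rfl
  have h2 : (fun x : ι → ℝ => ‖expFun ι x‖ ^ 2) = fun x => ∏ k, Real.exp (-2 * x k) := by
    ext x
    rw [expFun, Complex.norm_real, Real.norm_eq_abs, Real.abs_exp, ← Real.exp_nat_mul,
      ← Real.exp_sum, ← Finset.mul_sum]
    congr 1
    push_cast
    ring
  rw [h1, h2]
  refine Integrable.fintype_prod (f := fun _ t => Real.exp (-2 * t)) fun _ => ?_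
  rw [← IntegrableOn, integrableOn_Ici_iff_integrableOn_Ioi]
  exact integrableOn_exp_mul_Ioi (by norm_num) 0

/-- The vector `e^{-∑ x_k}` of `L²(ℝ₊^ι)`. -/
def expVector : L2Cone ι := (memLp_expFun ι).toLp

theorem expVector_coeFn : expVector ι =ᵐ[coneMeasure ι] expFun ι := MemLp.coeFn_toLp _

variable {ι}

theorem expFun_add (x y : ι → ℝ) : expFun ι (x + y) = expFun ι x * expFun ι y := by
  simp only [expFun, Pi.add_apply, Finset.sum_add_distrib, neg_add, Real.exp_add,
    Complex.ofReal_mul]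

theorem expFun_ne_zero (x : ι → ℝ) : expFun ι x ≠ 0 := by
  rw [expFun, Complex.ofReal_ne_zero]
  exact (Real.exp_pos _).ne'

theorem adjoint_shift_expVector (τ : ι → ℝ≥0) :
    adjoint (shift τ) (expVector ι) = ((Real.exp (-∑ k, (τ k : ℝ)) : ℝ) : ℂ) • expVector ι := by
  apply Lp.ext
  refine (adjoint_shift_ae τ (expVector_coeFn ι)).trans ?_
  filter_upwards [ae_restrict_mem measurableSet_Ici,
    Lp.coeFn_smul ((Real.exp (-∑ k, (τ k : ℝ)) : ℝ) : ℂ) (expVector ι), expVector_coeFn ι]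
    with x hx h1 h2
  have h3 : (x + fun k => (τ k : ℝ)) ∈ Set.Ici (0 : ι → ℝ) :=
    fun k => add_nonneg (hx k) (τ k).2
  rw [Set.indicator_of_mem h3, h1, Pi.smul_apply, h2, expFun_add, mul_comm]
  rfl

/-- Up to a nonzero constant, shifting the exponential only cuts it off to an orthant, so
orthogonality to all shifts is a statement about integrals over orthants. -/
theorem shift_expVector_ae (τ : ι → ℝ≥0) : shift τ (expVector ι) =ᵐ[coneMeasure ι]
    (Set.Ici fun k => (τ k : ℝ)).indicator
      fun x => expFun ι (-fun k => (τ k : ℝ)) * expFun ι x := by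
  refine (shift_ae τ (expVector_coeFn ι)).trans (.of_forall fun x => ?_)
  by_cases h : x ∈ Set.Ici fun k => (τ k : ℝ)
  · have h' : (x - fun k => (τ k : ℝ)) ∈ Set.Ici (0 : ι → ℝ) :=
      Set.mem_Ici.2 (sub_nonneg.2 (Set.mem_Ici.1 h))
    simp only
    rw [Set.indicator_of_mem h, Set.indicator_of_mem h', ← expFun_add, neg_add_eq_sub]
  · have h' : (x - fun k => (τ k : ℝ)) ∉ Set.Ici (0 : ι → ℝ) := fun h' =>
      h (Set.mem_Ici.2 (sub_nonneg.1 (Set.mem_Ici.1 h')))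
    simp only
    rw [Set.indicator_of_notMem h, Set.indicator_of_notMem h']

/-- An integrable function all of whose integrals over translated orthants vanish is zero. -/
theorem ae_eq_zero_of_setIntegral_Ici_eq_zero {μ : Measure (ι → ℝ)} {g : (ι → ℝ) → ℂ}
    (hg : Integrable g μ) (huniv : ∫ x, g x ∂μ = 0) (h : ∀ a, ∫ x in Set.Ici a, g x ∂μ = 0) :
    g =ᵐ[μ] 0 := by
  refine hg.ae_eq_zero_of_forall_setIntegral_eq_zero fun s hs hμ => ?_
  -- The induction runs over all measurable sets, since complements need not have finite measure.
  clear hμ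
  have hgen : (MeasurableSpace.pi : MeasurableSpace (ι → ℝ)) =
      MeasurableSpace.generateFrom
        (Set.pi Set.univ '' Set.pi Set.univ fun _ : ι => Set.range (Set.Ici : ℝ → Set ℝ)) := by
    refine (generateFrom_eq_pi (fun _ => ?_) fun _ => ?_).symm
    · rw [← borel_eq_generateFrom_Ici]
      exact (BorelSpace.measurable_eq (α := ℝ)).symm
    · refine ⟨fun n : ℕ => Set.Ici (-(n : ℝ)), fun n => ⟨_, rfl⟩, ?_⟩
      rw [Set.eq_univ_iff_forall]
      intro x
      obtain ⟨n, hn⟩ := exists_nat_ge (-x)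
      exact Set.mem_iUnion.2 ⟨n, Set.mem_Ici.2 (by linarith)⟩
  have hpi : IsPiSystem
      (Set.pi Set.univ '' Set.pi Set.univ fun _ : ι => Set.range (Set.Ici : ℝ → Set ℝ)) := by
    refine IsPiSystem.pi fun _ => ?_
    rintro _ ⟨a, rfl⟩ _ ⟨b, rfl⟩ _
    exact ⟨a ⊔ b, Set.Ici_inter_Ici.symm⟩
  induction s, hs using MeasurableSpace.induction_on_inter hgen hpi with
  | empty => simp
  | basic t ht =>
    obtain ⟨u, hu, rfl⟩ := ht
    choose a ha using fun i => hu i (Set.mem_univ i)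
    have : Set.pi Set.univ u = Set.Ici a := by
      rw [← Set.pi_univ_Ici]
      exact congrArg _ (funext fun i => (ha i).symm)
    rw [this, h]
  | compl t ht ih => rw [setIntegral_compl ht hg, huniv, ih, sub_zero]
  | iUnion f hd hm ih =>
    rw [integral_iUnion hm hd hg.integrableOn]
    simp [ih]

theorem dense_span_shift_expVector :
    Dense (Submodule.span ℂ (Set.range fun τ : ι → ℝ≥0 => shift τ (expVector ι)) :
      Set (L2Cone ι)) := by
  rw [Submodule.dense_iff_topologicalClosure_eq_top, Submodule.topologicalClosure_eq_top_iff,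
    Submodule.eq_bot_iff]
  intro f hf
  have hint : Integrable (fun x => expFun ι x * f x) (coneMeasure ι) :=
    (memLp_expFun ι).integrable_mul (Lp.memLp f)
  have h1 : ∀ τ : ι → ℝ≥0, ∫ x in Set.Ici fun k => (τ k : ℝ), expFun ι x * f x ∂coneMeasure ι = 0 := by
    intro τ
    have h2 := (Submodule.mem_orthogonal _ _).1 hf _ (Submodule.subset_span ⟨τ, rfl⟩)
    rw [L2.inner_def] at h2
    have h3 : (fun x => (inner ℂ (shift τ (expVector ι) x) (f x) : ℂ)) =ᵐ[coneMeasure ι]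
        (Set.Ici fun k => (τ k : ℝ)).indicator
          fun x => expFun ι (-fun k => (τ k : ℝ)) * (expFun ι x * f x) := by
      filter_upwards [shift_expVector_ae τ] with x hx
      rw [hx]
      by_cases h : x ∈ Set.Ici fun k => (τ k : ℝ)
      · rw [Set.indicator_of_mem h, Set.indicator_of_mem h, RCLike.inner_apply, map_mul]
        simp only [expFun, Complex.conj_ofReal]
        ring
      · rw [Set.indicator_of_notMem h, Set.indicator_of_notMem h, inner_zero_left]
    rw [integral_congr_ae h3, integral_indicator measurableSet_Ici, integral_const_mul] at h2
    exact (mul_eq_zero.1 h2).resolve_left (expFun_ne_zero _)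
  have h4 : ∀ a : ι → ℝ, ∫ x in Set.Ici a, expFun ι x * f x ∂coneMeasure ι = 0 := by
    intro a
    -- The measure lives on the cone, so negative coordinates of the corner `a` may be replaced by
    -- `0`.
    have h5 := h1 fun k => (a k).toNNReal
    rw [Measure.restrict_restrict measurableSet_Ici] at h5 ⊢
    convert h5 using 3
    ext x
    simp only [Set.mem_inter_iff, Set.mem_Ici, Pi.le_def, Real.coe_toNNReal', sup_le_iff,
      Pi.zero_apply]
    exact ⟨fun h => ⟨fun k => ⟨h.1 k, h.2 k⟩, h.2⟩, fun h => ⟨fun k => (h.1 k).1, h.2⟩⟩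
  have h5 : ∫ x, expFun ι x * f x ∂coneMeasure ι = 0 := by
    have := h4 0
    rwa [Measure.restrict_restrict measurableSet_Ici, Set.inter_self] at this
  apply Lp.ext
  filter_upwards [ae_eq_zero_of_setIntegral_Ici_eq_zero hint h5 h4,
    Lp.coeFn_zero ℂ 2 (coneMeasure ι)] with x hx h0
  rw [h0]
  exact (mul_eq_zero.1 hx).resolve_left (expFun_ne_zero _)

theorem expVector_ne_zero : expVector ι ≠ 0 := by
  intro h
  have h1 : expFun ι =ᵐ[coneMeasure ι] 0 :=
    (expVector_coeFn ι).symm.trans (h ▸ Lp.coeFn_zero ℂ 2 (coneMeasure ι))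
  have h2 : coneMeasure ι Set.univ = 0 := by
    refine measure_mono_null (fun x _ => ?_) (ae_iff.1 h1)
    exact expFun_ne_zero x
  rw [Measure.restrict_apply_univ, ← Set.pi_univ_Ici, volume_pi, Measure.pi_pi] at h2
  simp at h2

end ExpVector

/-! ### Vacuum vectors of the model representations -/

section TwistedShift

variable {d : ℕ} {ι : Type*} [Fintype ι] (p : Param d) (r : (Fin d → ℝ≥0) →+ (ι → ℝ≥0))
  (hr : Continuous r)

theorem twistedShift_op (t : Fin d → ℝ≥0) (f : L2Cone ι) :
    (twistedShift p r hr).op t f = phase p t • shift (r t) f := rfl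

theorem adjoint_twistedShift_op (t : Fin d → ℝ≥0) (f : L2Cone ι) :
    adjoint ((twistedShift p r hr).op t) f =
      (starRingEnd ℂ) (phase p t) • adjoint (shift (r t)) f := by
  have : (twistedShift p r hr).op t = phase p t • shift (r t) := rfl
  rw [this, map_smulₛₗ]
  rfl

theorem twistedShift_doublyCommuting
    (h : ∀ i j : Fin d, i ≠ j → ∀ s t : ℝ≥0, ∀ k, r (Pi.single i s) k = 0 ∨ r (Pi.single j t) k = 0) :
    DoublyCommuting (twistedShift p r hr) := by
  intro i j hij s t
  ext1 f
  rw [ContinuousLinearMap.comp_apply, ContinuousLinearMap.comp_apply, adjoint_twistedShift_op,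
    adjoint_twistedShift_op, twistedShift_op, twistedShift_op, map_smul, map_smul,
    shift_adjoint_shift_comm (h i j hij s t), smul_comm]

/-- A shift in directions untouched by `r` commutes with the adjoints, so it maps the exponential
vacuum to further vacuum vectors. -/
theorem twistedShift_isVacuum {u : ι → ℝ≥0} (hu : ∀ t k, u k = 0 ∨ r t k = 0)
    (hsum : ∀ t, ∑ k, (r t k : ℝ) = ∑ k : {k : Fin d // k ∈ p.1}, (t k : ℝ)) :
    IsVacuum (twistedShift p r hr) p (shift u (expVector ι)) := by
  intro t
  rw [adjoint_twistedShift_op, ← shift_adjoint_shift_comm (hu t), adjoint_shift_expVector, hsum,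
    map_smul, smul_smul]
  rfl

end TwistedShift

section Models

variable {d : ℕ} (p : Param d)

theorem irredRep_op (t : Fin d → ℝ≥0) (f : L2Cone {k : Fin d // k ∈ p.1}) :
    (irredRep p).op t f = phase p t • shift (fun k : {k : Fin d // k ∈ p.1} => t k) f := rfl

theorem irredRep_doublyCommuting : DoublyCommuting (irredRep p) := by
  refine twistedShift_doublyCommuting _ _ _ fun i j hij s t k => ?_
  change (Pi.single i s : Fin d → ℝ≥0) k = 0 ∨ (Pi.single j t : Fin d → ℝ≥0) k = 0
  by_cases h : (k : Fin d) = i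
  · exact Or.inr (Pi.single_eq_of_ne (h ▸ hij) _)
  · exact Or.inl (Pi.single_eq_of_ne h _)

theorem irredRep_isVacuum : IsVacuum (irredRep p) p (expVector {k : Fin d // k ∈ p.1}) := by
  have := twistedShift_isVacuum p (ι := {k : Fin d // k ∈ p.1})
    { toFun := fun t k => t k
      map_zero' := rfl
      map_add' := fun _ _ => rfl }
    (continuous_pi fun k => by simp; fun_prop) (u := 0) (fun _ _ => Or.inl rfl) (fun _ => rfl)
  rwa [shift_zero] at this

theorem phase_eq_one_of_forall {t : Fin d → ℝ≥0} (h : ∀ j, j ∉ p.1 → t j = 0) :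
    phase p t = 1 := by
  have : ∀ j : {j : Fin d // j ∉ p.1}, t j = 0 := fun j => h j j.2
  simp [phase, this]

theorem dense_span_irredRep : Dense (Submodule.span ℂ (Set.range fun t =>
    (irredRep p).op t (expVector {k : Fin d // k ∈ p.1})) :
      Set (L2Cone {k : Fin d // k ∈ p.1})) := by
  refine dense_span_shift_expVector.mono (Submodule.span_mono ?_)
  rintro _ ⟨τ, rfl⟩
  -- Extension by zero off `A` makes the phase trivial.
  refine ⟨fun k => if h : k ∈ p.1 then τ ⟨k, h⟩ else 0, ?_⟩
  simp only
  rw [irredRep_op, phase_eq_one_of_forall p (fun j hj => dif_neg hj), one_smul]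
  congr 2
  ext k
  simp

theorem irredRep_isIrred : IsIrred (irredRep p) :=
  (irredRep_isVacuum p).isIrred expVector_ne_zero (dense_span_irredRep p)

theorem modelRep_op (t : Fin d → ℝ≥0) (f : L2Cone (Fin d)) :
    (modelRep p).op t f = phase p t • shift (fun k => if k ∈ p.1 then t k else 0) f := rfl

theorem modelRep_doublyCommuting : DoublyCommuting (modelRep p) := by
  refine twistedShift_doublyCommuting _ _ _ fun i j hij s t k => ?_
  change (if k ∈ p.1 then (Pi.single i s : Fin d → ℝ≥0) k else 0) = 0 ∨
    (if k ∈ p.1 then (Pi.single j t : Fin d → ℝ≥0) k else 0) = 0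
  by_cases h : k = i
  · right
    rw [Pi.single_eq_of_ne (h ▸ hij), ite_self]
  · left
    rw [Pi.single_eq_of_ne h, ite_self]

theorem modelRep_isVacuum {u : Fin d → ℝ≥0} (hu : ∀ k ∈ p.1, u k = 0) :
    IsVacuum (modelRep p) p (shift u (expVector (Fin d))) := by
  refine twistedShift_isVacuum p _ _ (fun t k => ?_) fun t => ?_
  · change _ ∨ (if k ∈ p.1 then t k else 0) = 0
    by_cases hk : k ∈ p.1
    · exact Or.inl (hu k hk)
    · exact Or.inr (if_neg hk)
  · change ∑ k, ((if k ∈ p.1 then t k else 0 : ℝ≥0) : ℝ) = _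
    simp only [apply_ite NNReal.toReal, NNReal.coe_zero]
    rw [← Finset.sum_filter, Finset.filter_mem_eq_inter, Finset.univ_inter]
    exact (Finset.sum_coe_sort p.1 fun k => (t k : ℝ)).symm

theorem irredRep_op_single_of_notMem {j : Fin d} (hj : j ∉ p.1) (t : ℝ≥0)
    (f : L2Cone {k : Fin d // k ∈ p.1}) :
    (irredRep p).op (Pi.single j t) f = phase p (Pi.single j t) • f := by
  rw [irredRep_op]
  have : (fun k : {k : Fin d // k ∈ p.1} => (Pi.single j t : Fin d → ℝ≥0) k) = 0 := by
    ext k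
    simp [Pi.single_eq_of_ne (fun h : (k : Fin d) = j => hj (h ▸ k.2))]
  rw [this, shift_zero]
  rfl

/-- The vectors `V_t w` with `w` a vacuum vector. -/
def vacuumOrbits {H : Type*} [NormedAddCommGroup H] [InnerProductSpace ℂ H] [CompleteSpace H]
    (V : IsoRep (Fin d → ℝ≥0) H) (p : Param d) : Set H :=
  {x | ∃ t w, IsVacuum V p w ∧ V.op t w = x}

/-- A shift by `τ` splits into its part along `A`, which the representation performs, and its part
along the complement, which moves one vacuum vector to another. -/
theorem dense_span_modelRep :
    Dense (Submodule.span ℂ (vacuumOrbits (modelRep p) p) : Set (L2Cone (Fin d))) := by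
  refine dense_span_shift_expVector.mono (Submodule.span_mono ?_)
  rintro _ ⟨τ, rfl⟩
  refine ⟨fun k => if k ∈ p.1 then τ k else 0, _,
    modelRep_isVacuum p (u := fun k => if k ∈ p.1 then 0 else τ k) (fun k hk => if_pos hk), ?_⟩
  rw [modelRep_op, phase_eq_one_of_forall p (fun j hj => if_neg hj), one_smul,
    ← ContinuousLinearMap.comp_apply, ← shift_add]
  congr 2
  ext k
  by_cases hk : k ∈ p.1 <;> simp [hk]

end Models

/-! ### Tensoring with the identity -/

section TensorOne

variable {S : Type*} [AddMonoid S] [TopologicalSpace S]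
variable {E : Type*} [NormedAddCommGroup E] [InnerProductSpace ℂ E]
variable {K : Type*} [NormedAddCommGroup K] [InnerProductSpace ℂ K]

/-- The elementary tensor `x ⊗ y` in the Hilbert space tensor product, as a function of `x`. -/
def hilbertTmul (y : K) : E →L[ℂ] HilbertTensor E K :=
  LinearMap.mkContinuous
    ((UniformSpace.Completion.toComplₗᵢ (𝕜 := ℂ) (E := E ⊗[ℂ] K)).toLinearMap ∘ₗ
      (TensorProduct.mk ℂ E K).flip y) ‖y‖
    (fun x => by
      change ‖((x ⊗ₜ[ℂ] y : E ⊗[ℂ] K) : HilbertTensor E K)‖ ≤ _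
      rw [UniformSpace.Completion.norm_coe, TensorProduct.norm_tmul, mul_comm])

theorem hilbertTmul_apply (x : E) (y : K) :
    hilbertTmul y x = ((x ⊗ₜ[ℂ] y : E ⊗[ℂ] K) : HilbertTensor E K) := rfl

theorem inner_hilbertTmul (x x' : E) (y y' : K) :
    (inner ℂ (hilbertTmul y x) (hilbertTmul y' x') : ℂ) = inner ℂ x x' * inner ℂ y y' := by
  rw [hilbertTmul_apply, hilbertTmul_apply, UniformSpace.Completion.inner_coe,
    TensorProduct.inner_tmul]

theorem tensorOne_op_hilbertTmul (V : IsoRep S E) (s : S) (x : E) (y : K) :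
    (V.tensorOne K).op s (hilbertTmul y x) = hilbertTmul y (V.op s x) :=
  V.tensorOneOp_coe K s (x ⊗ₜ[ℂ] y)

theorem topologicalClosure_eq_top_of_hilbertTmul_mem {M : Submodule ℂ (HilbertTensor E K)}
    (h : ∀ (x : E) (y : K), hilbertTmul y x ∈ M) : M.topologicalClosure = ⊤ := by
  rw [← Submodule.dense_iff_topologicalClosure_eq_top]
  refine (UniformSpace.Completion.denseRange_coe (α := E ⊗[ℂ] K)).mono ?_
  rintro _ ⟨z, rfl⟩
  induction z using TensorProduct.induction_on with
  | zero => exact M.zero_mem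
  | tmul x y => exact h x y
  | add x y hx hy =>
    rw [UniformSpace.Completion.coe_add]
    exact M.add_mem hx hy

theorem separableSpace_hilbertTensor [TopologicalSpace.SeparableSpace E]
    [TopologicalSpace.SeparableSpace K] :
    TopologicalSpace.SeparableSpace (HilbertTensor E K) := by
  have h1 : TopologicalSpace.IsSeparable (Set.range fun z : E × K => z.1 ⊗ₜ[ℂ] z.2) :=
    TopologicalSpace.isSeparable_range TensorProduct.continuous_tmul
  have h2 := h1.span (R := ℂ)
  have h3 : Submodule.span ℂ (Set.range fun z : E × K => z.1 ⊗ₜ[ℂ] z.2) = ⊤ := by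
    rw [eq_top_iff, ← TensorProduct.span_tmul_eq_top]
    refine Submodule.span_mono ?_
    rintro _ ⟨x, y, rfl⟩
    exact ⟨(x, y), rfl⟩
  rw [h3] at h2
  have : TopologicalSpace.SeparableSpace (E ⊗[ℂ] K) := by
    rw [← TopologicalSpace.isSeparable_univ_iff]
    simpa using h2
  infer_instance

variable [CompleteSpace E]

/-- Both sides have the same inner products with elementary tensors, which are total. -/
theorem adjoint_tensorOne_op_hilbertTmul (V : IsoRep S E) (s : S) (x : E) (y : K) :
    adjoint ((V.tensorOne K).op s) (hilbertTmul y x) = hilbertTmul y (adjoint (V.op s) x) := by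
  have h : innerSL ℂ (adjoint ((V.tensorOne K).op s) (hilbertTmul y x)) =
      innerSL ℂ (hilbertTmul y (adjoint (V.op s) x)) := by
    refine ContinuousLinearMap.ext_on (s := Set.range fun z : E × K => hilbertTmul z.2 z.1) ?_ ?_
    · rw [Submodule.dense_iff_topologicalClosure_eq_top]
      exact topologicalClosure_eq_top_of_hilbertTmul_mem fun x y =>
        Submodule.subset_span ⟨(x, y), rfl⟩
    · rintro _ ⟨z, rfl⟩
      simp only [innerSL_apply_apply]
      rw [ContinuousLinearMap.adjoint_inner_left, tensorOne_op_hilbertTmul, inner_hilbertTmul,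
        inner_hilbertTmul, ContinuousLinearMap.adjoint_inner_left]
  exact ext_inner_right ℂ fun z => congrArg (fun A => A z) h

variable {d : ℕ}

theorem DoublyCommuting.tensorOne {V : IsoRep (Fin d → ℝ≥0) E} (hV : DoublyCommuting V) :
    DoublyCommuting (V.tensorOne K) := by
  intro i j hij s t
  refine IsoRep.tensorOneOp_ext K fun x y => ?_
  rw [← hilbertTmul_apply, ContinuousLinearMap.comp_apply, ContinuousLinearMap.comp_apply,
    adjoint_tensorOne_op_hilbertTmul, tensorOne_op_hilbertTmul, tensorOne_op_hilbertTmul,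
    adjoint_tensorOne_op_hilbertTmul]
  exact congrArg (fun A => hilbertTmul y (A x)) (hV i j hij s t)

theorem IsVacuum.tensorOne {V : IsoRep (Fin d → ℝ≥0) E} {p : Param d} {w : E}
    (hw : IsVacuum V p w) (y : K) : IsVacuum (V.tensorOne K) p (hilbertTmul y w) := fun t => by
  rw [adjoint_tensorOne_op_hilbertTmul, hw, map_smul]

theorem dense_span_tensorOne {V : IsoRep (Fin d → ℝ≥0) E} {p : Param d}
    (hd : Dense (Submodule.span ℂ (vacuumOrbits V p) : Set E)) :
    Dense (Submodule.span ℂ (vacuumOrbits (V.tensorOne K) p) : Set (HilbertTensor E K)) := by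
  rw [Submodule.dense_iff_topologicalClosure_eq_top]
  set M := Submodule.span ℂ (vacuumOrbits (V.tensorOne K) p)
  have h1 : ∀ (x : E) (y : K), hilbertTmul y x ∈ M.topologicalClosure := by
    intro x y
    have h2 : IsClosed ((hilbertTmul y : E →L[ℂ] HilbertTensor E K) ⁻¹' M.topologicalClosure) :=
      M.isClosed_topologicalClosure.preimage (hilbertTmul y).continuous
    refine h2.closure_subset_iff.2 ?_ (hd x)
    change (Submodule.span ℂ (vacuumOrbits V p) : Set E) ⊆
      (M.topologicalClosure.comap
        ((hilbertTmul y : E →L[ℂ] HilbertTensor E K) : E →ₗ[ℂ] HilbertTensor E K) : Set E)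
    rw [SetLike.coe_subset_coe, Submodule.span_le]
    rintro _ ⟨t, w, hw, rfl⟩
    refine M.le_topologicalClosure (Submodule.subset_span ⟨t, _, hw.tensorOne y, ?_⟩)
    exact tensorOne_op_hilbertTmul V t w y
  have := topologicalClosure_eq_top_of_hilbertTmul_mem h1
  rwa [IsClosed.submodule_topologicalClosure_eq M.isClosed_topologicalClosure] at this

end TensorOne

/-! ### Unitary equivalence -/

section Equivalence

variable {S : Type*} [AddMonoid S] [TopologicalSpace S]
variable {H : Type*} [NormedAddCommGroup H] [InnerProductSpace ℂ H]
variable {H' : Type*} [NormedAddCommGroup H'] [InnerProductSpace ℂ H']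
variable {H'' : Type*} [NormedAddCommGroup H''] [InnerProductSpace ℂ H'']
variable {V : IsoRep S H} {W : IsoRep S H'}

theorem UnitarilyEquiv.symm (h : UnitarilyEquiv V W) : UnitarilyEquiv W V := by
  obtain ⟨U, hU⟩ := h
  refine ⟨U.symm, fun s x => ?_⟩
  rw [LinearIsometryEquiv.symm_apply_eq, hU, LinearIsometryEquiv.apply_symm_apply]

theorem UnitarilyEquiv.trans {Z : IsoRep S H''} (h : UnitarilyEquiv V W)
    (h' : UnitarilyEquiv W Z) : UnitarilyEquiv V Z := by
  obtain ⟨U, hU⟩ := h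
  obtain ⟨U', hU'⟩ := h'
  exact ⟨U.trans U', fun s x => by simp [hU, hU']⟩

theorem map_adjoint_op [CompleteSpace H] [CompleteSpace H'] {U : H ≃ₗᵢ[ℂ] H'}
    (hU : ∀ s x, U (V.op s x) = W.op s (U x)) (s : S) (x : H) :
    U (adjoint (V.op s) x) = adjoint (W.op s) (U x) := by
  refine ext_inner_right ℂ fun y => ?_
  obtain ⟨z, rfl⟩ := U.surjective y
  rw [U.inner_map_map, ContinuousLinearMap.adjoint_inner_left,
    ContinuousLinearMap.adjoint_inner_left, ← hU, U.inner_map_map]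

theorem IsIrred.of_unitarilyEquiv [CompleteSpace H] [CompleteSpace H'] (hV : IsIrred V)
    (h : UnitarilyEquiv V W) : IsIrred W := by
  obtain ⟨U, hU⟩ := h
  have := hV.1
  refine ⟨U.toEquiv.symm.nontrivial, fun T hT => ?_⟩
  let A : H →L[ℂ] H := (U.symm : H' →L[ℂ] H) ∘L T ∘L (U : H →L[ℂ] H')
  have hA : ∀ x, A x = U.symm (T (U x)) := fun _ => rfl
  obtain ⟨c, hc⟩ := hV.2 A fun s => ⟨by
    ext x
    have := congrArg (fun B => B (U x)) (hT s).1
    simp only [ContinuousLinearMap.comp_apply] at this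
    change A (V.op s x) = V.op s (A x)
    rw [hA, hA, hU, this,
      LinearIsometryEquiv.symm_apply_eq, hU, LinearIsometryEquiv.apply_symm_apply], by
    ext x
    have := congrArg (fun B => B (U x)) (hT s).2
    simp only [ContinuousLinearMap.comp_apply] at this
    change A (adjoint (V.op s) x) = adjoint (V.op s) (A x)
    rw [hA, hA, map_adjoint_op hU, this, LinearIsometryEquiv.symm_apply_eq, map_adjoint_op hU,
      LinearIsometryEquiv.apply_symm_apply]⟩
  refine ⟨c, ?_⟩
  ext y
  have := congrArg (fun B => U (B (U.symm y))) hc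
  simpa [hA] using this

end Equivalence

/-! ### Infinite multiples -/

section Multiple

variable {S : Type*} [AddMonoid S] [TopologicalSpace S]
variable {H : Type*} [NormedAddCommGroup H] [InnerProductSpace ℂ H]
variable {H' : Type*} [NormedAddCommGroup H'] [InnerProductSpace ℂ H']
variable {H'' : Type*} [NormedAddCommGroup H''] [InnerProductSpace ℂ H'']

/-- An isometry applied to each entry of a square summable sequence. -/
def lpMap (J : H →ₗᵢ[ℂ] H') (f : lp (fun _ : ℕ => H) 2) : lp (fun _ : ℕ => H') 2 :=
  ⟨fun n => J (f n), by
    have h := (memℓp_gen_iff (by norm_num)).1 (lp.memℓp f)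
    exact (memℓp_gen_iff (by norm_num)).2 (by simpa using h)⟩

theorem IsInfiniteMultiple.congr_right {V : IsoRep S H} {W : IsoRep S H'} {W' : IsoRep S H''}
    (h : IsInfiniteMultiple V W) (h' : UnitarilyEquiv W W') : IsInfiniteMultiple V W' := by
  obtain ⟨U, hU⟩ := h
  obtain ⟨J, hJ⟩ := h'
  let e : lp (fun _ : ℕ => H') 2 ≃ₗᵢ[ℂ] lp (fun _ : ℕ => H'') 2 :=
    { toFun := lpMap J.toLinearIsometry
      invFun := lpMap J.symm.toLinearIsometry
      map_add' := fun f g => by ext n; exact map_add J _ _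
      map_smul' := fun c f => by ext n; exact map_smul J _ _
      left_inv := fun f => by ext n; exact J.symm_apply_apply _
      right_inv := fun f => by ext n; exact J.apply_symm_apply _
      norm_map' := fun f => by
        rw [lp.norm_eq_tsum_rpow (by norm_num), lp.norm_eq_tsum_rpow (by norm_num)]
        simp [lpMap] }
  refine ⟨U.trans e, fun s x n => ?_⟩
  change J (U (V.op s x) n) = W'.op s (J (U x n))
  rw [hU, hJ]

theorem IsInfiniteMultiple.unitarilyEquiv {V : IsoRep S H} {V' : IsoRep S H'} {W : IsoRep S H''}
    (h : IsInfiniteMultiple V W) (h' : IsInfiniteMultiple V' W) : UnitarilyEquiv V V' := by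
  obtain ⟨U, hU⟩ := h
  obtain ⟨U', hU'⟩ := h'
  refine ⟨U.trans U'.symm, fun s x => ?_⟩
  rw [LinearIsometryEquiv.trans_apply, LinearIsometryEquiv.symm_apply_eq]
  ext n
  rw [hU, hU', LinearIsometryEquiv.trans_apply, LinearIsometryEquiv.apply_symm_apply]

variable (H') in
/-- The inclusion of the first summand into the space of square summable sequences. -/
def lpFirst : H' →ₗᵢ[ℂ] lp (fun _ : ℕ => H') 2 where
  toFun x := lp.single (E := fun _ : ℕ => H') 2 0 x
  map_add' x y := (lp.lsingle (𝕜 := ℂ) (E := fun _ : ℕ => H') 2 0).map_add x y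
  map_smul' c x := (lp.lsingle (𝕜 := ℂ) (E := fun _ : ℕ => H') 2 0).map_smul c x
  norm_map' x := lp.norm_single (E := fun _ : ℕ => H') (p := 2) (by norm_num) 0 x

theorem inner_lpFirst (x : H') (f : lp (fun _ : ℕ => H') 2) :
    (inner ℂ (lpFirst H' x) f : ℂ) = inner ℂ x (f 0) :=
  lp.inner_single_left (G := fun _ : ℕ => H') 0 x f

theorem lpFirst_map (T : H' →L[ℂ] H') (x : H') (n : ℕ) :
    lpFirst H' (T x) n = T (lpFirst H' x n) := by
  by_cases hn : n = 0
  · subst hn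
    exact (lp.single_apply_self (E := fun _ : ℕ => H') 2 0 (T x)).trans
      (congrArg T (lp.single_apply_self (E := fun _ : ℕ => H') 2 0 x)).symm
  · exact (lp.single_apply_ne (E := fun _ : ℕ => H') 2 0 (T x) hn).trans
      ((congrArg T (lp.single_apply_ne (E := fun _ : ℕ => H') 2 0 x hn)).trans (map_zero T)).symm

/-- The first summand of an infinite multiple. -/
theorem IsInfiniteMultiple.exists_intertwining [CompleteSpace H] [CompleteSpace H']
    {V : IsoRep S H} {W : IsoRep S H'} (h : IsInfiniteMultiple V W) :
    ∃ J : H' →ₗᵢ[ℂ] H, (∀ s x, J (W.op s x) = V.op s (J x)) ∧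
      ∀ s x, J (adjoint (W.op s) x) = adjoint (V.op s) (J x) := by
  obtain ⟨U, hU⟩ := h
  have hJ : ∀ x y, (inner ℂ (U.symm (lpFirst H' x)) y : ℂ) = inner ℂ x (U y 0) := fun x y => by
    rw [← U.inner_map_map, U.apply_symm_apply, inner_lpFirst]
  refine ⟨U.symm.toLinearIsometry.comp (lpFirst H'), fun s x => ?_, fun s x => ?_⟩
  · change U.symm (lpFirst H' (W.op s x)) = V.op s (U.symm (lpFirst H' x))
    rw [LinearIsometryEquiv.symm_apply_eq]
    ext n
    rw [hU, LinearIsometryEquiv.apply_symm_apply, lpFirst_map]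
  · change U.symm (lpFirst H' (adjoint (W.op s) x)) = adjoint (V.op s) (U.symm (lpFirst H' x))
    refine ext_inner_right ℂ fun y => ?_
    rw [hJ, ContinuousLinearMap.adjoint_inner_left, ContinuousLinearMap.adjoint_inner_left, hJ, hU]

theorem IsInfiniteMultiple.doublyCommuting {d : ℕ} [CompleteSpace H] [CompleteSpace H']
    {V : IsoRep (Fin d → ℝ≥0) H} {W : IsoRep (Fin d → ℝ≥0) H'} (h : IsInfiniteMultiple V W)
    (hV : DoublyCommuting V) : DoublyCommuting W := by
  obtain ⟨J, hJ, hJ'⟩ := h.exists_intertwining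
  intro i j hij s t
  ext x
  apply J.injective
  have := congrArg (fun A => A (J x)) (hV i j hij s t)
  simp only [ContinuousLinearMap.comp_apply] at this ⊢
  rw [hJ, hJ', hJ', hJ, this]

/-- `IsRailway` asks for a space in the universe of `H`, so `W` is transported to its first copy
inside `H`. -/
theorem IsInfiniteMultiple.isRailway [CompleteSpace H] [CompleteSpace H'] {V : IsoRep S H}
    {W : IsoRep S H'} (h : IsInfiniteMultiple V W) (hW : IsIrred W) : IsRailway V := by
  obtain ⟨J, hJ, -⟩ := h.exists_intertwining
  let F : Submodule ℂ H := LinearMap.range J.toLinearMap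
  have hF : CompleteSpace F := (J.isometry.isClosedEmbedding.isClosed_range).completeSpace_coe
  have hinv : ∀ s, ∀ x ∈ F, V.op s x ∈ F := by
    rintro s _ ⟨x, rfl⟩
    exact ⟨W.op s x, hJ s x⟩
  have he : UnitarilyEquiv W (V.restrict F hinv) :=
    ⟨J.equivRange, fun s x => Subtype.ext (hJ s x)⟩
  exact ⟨F, inferInstance, inferInstance, hF, V.restrict F hinv, hW.of_unitarilyEquiv he,
    h.congr_right he⟩

theorem exists_orthonormal_sequence (E : Type*) [NormedAddCommGroup E] [InnerProductSpace ℂ E]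
    [CompleteSpace E] [TopologicalSpace.SeparableSpace E] (hE : ¬ FiniteDimensional ℂ E) :
    ∃ v : ℕ → E, Orthonormal ℂ v ∧ Dense (Submodule.span ℂ (Set.range v) : Set E) := by
  obtain ⟨w, b, hb⟩ := exists_hilbertBasis ℂ E
  have ho : Orthonormal ℂ ((↑) : w → E) := hb ▸ b.orthonormal
  have hs : Dense (Submodule.span ℂ w : Set E) := by
    rw [Submodule.dense_iff_topologicalClosure_eq_top, ← b.dense_span, hb, Subtype.range_coe]
  have hc : Countable w := by
    -- Distinct basis vectors are `√2` apart, so balls of radius `1/2` around them are disjoint and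
    -- separability leaves only countably many.
    have hdist : ∀ i j : w, i ≠ j → 1 ≤ dist (i : E) j := fun i j hij => by
      have h1 : ‖(i : E) - j‖ ^ 2 = 2 := by
        rw [norm_sub_sq (𝕜 := ℂ), ho.1, ho.1, ho.2 hij]
        norm_num
      rw [dist_eq_norm]
      nlinarith [norm_nonneg ((i : E) - j)]
    refine Set.countable_coe_iff.2 (Set.PairwiseDisjoint.countable_of_isOpen
      (s := fun x : E => Metric.ball x (1 / 2)) ?_ (fun _ _ => Metric.isOpen_ball)
      (fun x _ => ⟨x, Metric.mem_ball_self (by norm_num)⟩))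
    intro x hx y hy hxy
    exact Metric.ball_disjoint_ball (by
      have := hdist ⟨x, hx⟩ ⟨y, hy⟩ (fun h => hxy (congrArg Subtype.val h))
      norm_num
      exact this)
  have hi : Infinite w := by
    by_contra hfin
    have hfin' : Finite w := not_infinite_iff_finite.1 hfin
    refine hE ?_
    have hfd : FiniteDimensional ℂ (Submodule.span ℂ w) :=
      FiniteDimensional.span_of_finite ℂ (Set.toFinite w)
    have h1 := (Submodule.closed_of_finiteDimensional (Submodule.span ℂ w)).closure_eq
    have h2 : Submodule.span ℂ w = ⊤ := by
      rw [Submodule.eq_top_iff']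
      intro x
      have := hs x
      rwa [h1] at this
    rw [h2] at hfd
    exact Module.Finite.of_surjective (Submodule.subtype (⊤ : Submodule ℂ E))
      (fun x => ⟨⟨x, trivial⟩, rfl⟩)
  obtain ⟨e⟩ : Nonempty (w ≃ ℕ) := (nonempty_denumerable w).map fun hd => hd.eqv w
  refine ⟨fun n => (e.symm n : E), ho.comp _ e.symm.injective, ?_⟩
  have : Set.range (fun n => (e.symm n : E)) = w := by
    rw [show (fun n => (e.symm n : E)) = Subtype.val ∘ e.symm from rfl, e.symm.surjective.range_comp,
      Subtype.range_coe]
  rwa [this]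

variable {d : ℕ}

/-- The subspace of vacuum vectors. -/
def vacuumSpace [CompleteSpace H] (V : IsoRep (Fin d → ℝ≥0) H) (p : Param d) : Submodule ℂ H where
  carrier := {w | IsVacuum V p w}
  add_mem' hv hw t := by rw [map_add, hv, hw, smul_add]
  zero_mem' t := by simp
  smul_mem' c w hw t := by rw [map_smul, hw, smul_comm]

theorem isClosed_vacuumSpace [CompleteSpace H] (V : IsoRep (Fin d → ℝ≥0) H) (p : Param d) :
    IsClosed (vacuumSpace V p : Set H) := by
  have : (vacuumSpace V p : Set H) =
      ⋂ t, {w | adjoint (V.op t) w = vacuumCoeff p t • w} := by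
    ext w
    simp [vacuumSpace, IsVacuum]
  rw [this]
  exact isClosed_iInter fun t =>
    isClosed_eq (adjoint (V.op t)).continuous (continuous_const_smul _)

/-- A doubly commuting representation that is generated by an infinite-dimensional space of vacuum
vectors is an infinite multiple of any representation with a cyclic vacuum vector. -/
theorem isInfiniteMultiple_of_vacuum [CompleteSpace H] [TopologicalSpace.SeparableSpace H]
    [CompleteSpace H'] {V : IsoRep (Fin d → ℝ≥0) H} {W : IsoRep (Fin d → ℝ≥0) H'} {p : Param d}
    (hV : DoublyCommuting V) (hW : DoublyCommuting W)
    (hgen : Dense (Submodule.span ℂ (vacuumOrbits V p) : Set H))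
    (hinf : ¬ FiniteDimensional ℂ (vacuumSpace V p)) {w : H'} (hw : IsVacuum W p w) (hw0 : w ≠ 0)
    (hcyc : Dense (Submodule.span ℂ (Set.range fun t => W.op t w) : Set H')) :
    IsInfiniteMultiple V W := by
  have hc : CompleteSpace (vacuumSpace V p) := (isClosed_vacuumSpace V p).completeSpace_coe
  have hsep : TopologicalSpace.SeparableSpace (vacuumSpace V p) := by
    have : SecondCountableTopology H := UniformSpace.secondCountable_of_separable H
    infer_instance
  obtain ⟨v, hvo, hvd⟩ := exists_orthonormal_sequence (vacuumSpace V p) hinf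
  -- The basis vectors are rescaled to the norm of `w`, as `IsVacuum.exists_intertwining` requires.
  have hcoe : ∀ n, IsVacuum V p ((‖w‖ : ℂ) • (v n : H)) := fun n =>
    (vacuumSpace V p).smul_mem _ (v n).2
  have hnorm : ∀ n, ‖(‖w‖ : ℂ) • (v n : H)‖ = ‖w‖ := fun n => by
    rw [norm_smul, Submodule.norm_coe, hvo.1, mul_one]
    simp
  choose J hJw hJ hJ' using fun n => (hcoe n).exists_intertwining hV hW hw (hnorm n) hcyc
  have hJt : ∀ n t, J n (W.op t w) = V.op t ((‖w‖ : ℂ) • (v n : H)) := fun n t => by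
    rw [hJ, hJw]
  have horth : OrthogonalFamily ℂ (fun _ : ℕ => H') J := by
    intro m n hmn x y
    -- Orthogonality of `v m` and `v n` spreads to their orbits by `IsVacuum.inner_op`, then to the
    -- full ranges by density in each argument in turn.
    have h1 : ∀ s t, (inner ℂ (J m (W.op s w)) (J n (W.op t w)) : ℂ) = 0 := fun s t => by
      have h2 : (inner ℂ (v m) (v n) : ℂ) = 0 := hvo.2 hmn
      rw [Submodule.coe_inner] at h2
      rw [hJt, hJt, (hcoe m).inner_op hV (hcoe n), inner_smul_left, inner_smul_right, h2]
      simp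
    have h2 : ∀ s, innerSL ℂ (J m (W.op s w)) ∘L (J n).toContinuousLinearMap = 0 := fun s => by
      refine ContinuousLinearMap.ext_on hcyc ?_
      rintro _ ⟨t, rfl⟩
      exact h1 s t
    have h3 : innerSL ℂ (J n y) ∘L (J m).toContinuousLinearMap = 0 := by
      refine ContinuousLinearMap.ext_on hcyc ?_
      rintro _ ⟨s, rfl⟩
      have h4 : (inner ℂ (J m (W.op s w)) (J n y) : ℂ) = 0 := congrArg (fun A => A y) (h2 s)
      change (inner ℂ (J n y) (J m (W.op s w)) : ℂ) = 0
      rw [← inner_conj_symm, h4, map_zero]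
    have h4 : (inner ℂ (J n y) (J m x) : ℂ) = 0 := congrArg (fun A => A x) h3
    rw [← inner_conj_symm, h4, map_zero]
  have htot : ⊤ ≤ (⨆ n, LinearMap.range (J n).toLinearMap).topologicalClosure := by
    set M := (⨆ n, LinearMap.range (J n).toLinearMap).topologicalClosure with hM
    have h1 : ∀ n t, V.op t (v n : H) ∈ M := fun n t => by
      have h2 : V.op t (v n : H) = J n ((‖w‖ : ℂ)⁻¹ • W.op t w) := by
        rw [map_smul, hJt, map_smul, smul_smul, inv_mul_cancel₀, one_smul]
        exact_mod_cast norm_ne_zero_iff.2 hw0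
      rw [h2]
      exact Submodule.le_topologicalClosure _ (Submodule.mem_iSup_of_mem n ⟨_, rfl⟩)
    have hMc : IsClosed (M : Set H) := Submodule.isClosed_topologicalClosure _
    have h2 : ∀ t (u : vacuumSpace V p), V.op t (u : H) ∈ M := fun t u => by
      let A : vacuumSpace V p →L[ℂ] H := V.op t ∘L (vacuumSpace V p).subtypeL
      have h3 : IsClosed (A ⁻¹' (M : Set H)) := hMc.preimage A.continuous
      refine h3.closure_subset_iff.2 ?_ (hvd u)
      change (Submodule.span ℂ (Set.range v) : Set (vacuumSpace V p)) ⊆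
        (M.comap (A : vacuumSpace V p →ₗ[ℂ] H) : Set (vacuumSpace V p))
      rw [SetLike.coe_subset_coe, Submodule.span_le]
      rintro _ ⟨n, rfl⟩
      exact h1 n t
    have h3 : Submodule.span ℂ (vacuumOrbits V p) ≤ M := by
      rw [Submodule.span_le]
      rintro _ ⟨t, u, hu, rfl⟩
      exact h2 t ⟨u, hu⟩
    intro x _
    exact hMc.closure_subset_iff.2 h3 (hgen x)
  have hsum : IsHilbertSum ℂ (fun _ : ℕ => H') J := IsHilbertSum.mk horth htot
  refine ⟨hsum.linearIsometryEquiv, fun s x n => ?_⟩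
  set U := hsum.linearIsometryEquiv
  -- Intertwining is checked on the inverse, where `V.op s` can be applied term by term to the sum
  -- of the `J n`.
  have h1 : U.symm (lpMap ⟨(W.op s : H' →ₗ[ℂ] H'), W.norm_op s⟩ (U x)) = V.op s x := by
    refine (hsum.hasSum_linearIsometryEquiv_symm _).unique ?_
    have h2 := (hsum.hasSum_linearIsometryEquiv_symm (U x)).mapL (V.op s)
    rw [show hsum.linearIsometryEquiv.symm (U x) = x from U.symm_apply_apply x] at h2
    convert! h2 using 1
    ext n
    exact hJ n s _
  rw [← h1, LinearIsometryEquiv.apply_symm_apply]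
  rfl

end Multiple

/-! ### The classification -/

section Classification

variable {d : ℕ}

/-- The map `y ↦ w ⊗ y` embeds `K` into the vacuum space. -/
theorem not_finiteDimensional_vacuumSpace_tensorOne {E : Type*} [NormedAddCommGroup E]
    [InnerProductSpace ℂ E] [CompleteSpace E] {K : Type*} [NormedAddCommGroup K]
    [InnerProductSpace ℂ K] (hK : ¬ FiniteDimensional ℂ K) {V : IsoRep (Fin d → ℝ≥0) E}
    {p : Param d} {w : E} (hw : IsVacuum V p w) (hw0 : w ≠ 0) :
    ¬ FiniteDimensional ℂ (vacuumSpace (V.tensorOne K) p) := by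
  intro hfin
  let L : K →ₗ[ℂ] HilbertTensor E K :=
    (UniformSpace.Completion.toComplₗᵢ (𝕜 := ℂ) (E := E ⊗[ℂ] K)).toLinearMap ∘ₗ
      TensorProduct.mk ℂ E K w
  have hL : ∀ y, L y = hilbertTmul y w := fun _ => rfl
  have hmem : ∀ y, L y ∈ vacuumSpace (V.tensorOne K) p := fun y => hw.tensorOne y
  refine hK (FiniteDimensional.of_injective (L.codRestrict _ hmem) ?_)
  rw [← LinearMap.ker_eq_bot, LinearMap.ker_codRestrict, LinearMap.ker_eq_bot']
  intro y hy
  have h1 := inner_hilbertTmul w w y y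
  rw [← hL, hy, inner_zero_left] at h1
  have h2 := (mul_eq_zero.1 h1.symm).resolve_left (inner_self_ne_zero.2 hw0)
  exact inner_self_eq_zero.1 h2

theorem modelRep_tensorOne_isInfiniteMultiple (p : Param d) (K : Type*) [NormedAddCommGroup K]
    [InnerProductSpace ℂ K] [TopologicalSpace.SeparableSpace K] (hK : ¬ FiniteDimensional ℂ K) :
    IsInfiniteMultiple ((modelRep p).tensorOne K) (irredRep p) := by
  have : Fact ((2 : ℝ≥0∞) ≠ ∞) := ⟨by norm_num⟩
  have : TopologicalSpace.SeparableSpace (L2Cone (Fin d)) := inferInstance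
  have := separableSpace_hilbertTensor (E := L2Cone (Fin d)) (K := K)
  have hvac : IsVacuum (modelRep p) p (expVector (Fin d)) := by
    simpa [shift_zero] using modelRep_isVacuum p (u := 0) fun _ _ => rfl
  exact isInfiniteMultiple_of_vacuum (modelRep_doublyCommuting p).tensorOne
    (irredRep_doublyCommuting p) (dense_span_tensorOne (dense_span_modelRep p))
    (not_finiteDimensional_vacuumSpace_tensorOne hK hvac expVector_ne_zero)
    (irredRep_isVacuum p) expVector_ne_zero (dense_span_irredRep p)

theorem IsIrred.exists_unitarilyEquiv_irredRep {H : Type*} [NormedAddCommGroup H]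
    [InnerProductSpace ℂ H] [CompleteSpace H] {V : IsoRep (Fin d → ℝ≥0) H} (hV : IsIrred V)
    (hD : DoublyCommuting V) : ∃ p : Param d, UnitarilyEquiv V (irredRep p) := by
  obtain ⟨p, w, hw, hw0⟩ := hV.exists_isVacuum hD
  let c : ℂ := (‖expVector {k : Fin d // k ∈ p.1}‖ / ‖w‖ : ℝ)
  have hcw : IsVacuum V p (c • w) := (vacuumSpace V p).smul_mem c hw
  obtain ⟨J, -, hJ, hJ'⟩ := hcw.exists_intertwining hD (irredRep_doublyCommuting p)
    (irredRep_isVacuum p) (by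
      rw [norm_smul, Complex.norm_real, Real.norm_of_nonneg (by positivity),
        div_mul_cancel₀ _ (norm_ne_zero_iff.2 hw0)]) (dense_span_irredRep p)
  have := (irredRep_isIrred p).1
  exact ⟨p, UnitarilyEquiv.symm ⟨LinearIsometryEquiv.ofSurjective J
    (hV.surjective_of_intertwining J hJ hJ'), hJ⟩⟩

/-- The coordinate semigroup `j` is the character with frequency `m`. -/
def IsScalarAt {H : Type*} [NormedAddCommGroup H] [InnerProductSpace ℂ H]
    (V : IsoRep (Fin d → ℝ≥0) H) (j : Fin d) (m : ℝ) : Prop :=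
  ∀ (t : ℝ≥0) (x : H), V.op (Pi.single j t) x = Complex.exp (Complex.I * ((t * m : ℝ) : ℂ)) • x

/-- The coordinate semigroups of `V` that are characters are those prescribed by `p`. -/
def HasType {H : Type*} [NormedAddCommGroup H] [InnerProductSpace ℂ H]
    (V : IsoRep (Fin d → ℝ≥0) H) (p : Param d) : Prop :=
  ∀ j m, IsScalarAt V j m ↔ ∃ h : j ∉ p.1, p.2 ⟨j, h⟩ = m

section

variable {H : Type*} [NormedAddCommGroup H] [InnerProductSpace ℂ H]
  {H' : Type*} [NormedAddCommGroup H'] [InnerProductSpace ℂ H']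
  {V : IsoRep (Fin d → ℝ≥0) H} {W : IsoRep (Fin d → ℝ≥0) H'} {p q : Param d}

theorem eq_of_forall_isScalarAt_iff (hp : HasType V p) (hq : HasType W q)
    (h : ∀ j m, IsScalarAt V j m ↔ IsScalarAt W j m) : p = q := by
  have key : ∀ j m, (∃ h : j ∉ p.1, p.2 ⟨j, h⟩ = m) ↔ ∃ h : j ∉ q.1, q.2 ⟨j, h⟩ = m := fun j m => by
    rw [← hp, ← hq, h]
  obtain ⟨A, l⟩ := p
  obtain ⟨B, m⟩ := q
  have hAB : A = B := by
    ext j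
    rw [← not_iff_not]
    exact ⟨fun hj => ((key j _).1 ⟨hj, rfl⟩).1, fun hj => ((key j _).2 ⟨hj, rfl⟩).1⟩
  subst hAB
  congr 1
  ext j
  exact ((key j _).1 ⟨j.2, rfl⟩).2.symm

theorem UnitarilyEquiv.isScalarAt (h : UnitarilyEquiv V W) {j : Fin d} {m : ℝ}
    (hV : IsScalarAt V j m) : IsScalarAt W j m := by
  obtain ⟨U, hU⟩ := h
  intro t y
  obtain ⟨x, rfl⟩ := U.surjective y
  rw [← hU, hV, map_smul]

theorem UnitarilyEquiv.isScalarAt_iff (h : UnitarilyEquiv V W) (j : Fin d) (m : ℝ) :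
    IsScalarAt V j m ↔ IsScalarAt W j m :=
  ⟨h.isScalarAt, h.symm.isScalarAt⟩

theorem UnitarilyEquiv.hasType (h : UnitarilyEquiv V W) (hW : HasType W p) : HasType V p :=
  fun j m => (h.isScalarAt_iff j m).trans (hW j m)

theorem eq_of_forall_exp_eq {a b : ℝ} (h : ∀ t : ℝ≥0,
    Complex.exp (Complex.I * ((t * a : ℝ) : ℂ)) = Complex.exp (Complex.I * ((t * b : ℝ) : ℂ))) :
    a = b := by
  by_contra hab
  have hne : a - b ≠ 0 := sub_ne_zero.2 hab
  -- At this time the quotient of the two exponentials is `e^{±iπ} = -1`.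
  have h1 := h ⟨Real.pi / |a - b|, by positivity⟩
  have h2 : Complex.exp (((Real.pi / |a - b| * (a - b) : ℝ) : ℂ) * Complex.I) = 1 := by
    rw [← sub_eq_zero, ← mul_left_inj' (Complex.exp_ne_zero
      (Complex.I * ((Real.pi / |a - b| * b : ℝ) : ℂ))), sub_mul, ← Complex.exp_add, one_mul,
      zero_mul, sub_eq_zero]
    refine Eq.trans ?_ h1
    congr 1
    push_cast
    change _ = Complex.I * (((Real.pi / |a - b| : ℝ) : ℂ) * a)
    push_cast
    ring
  rcases abs_choice (a - b) with h3 | h3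
  · rw [h3, div_mul_cancel₀ _ hne, Complex.exp_pi_mul_I] at h2
    norm_num at h2
  · rw [h3, div_neg, neg_mul, div_mul_cancel₀ _ hne, Complex.ofReal_neg, neg_mul, Complex.exp_neg,
      Complex.exp_pi_mul_I] at h2
    norm_num at h2

/-- If axis `j` is a character, the vacuum eigenvalue is its conjugate. For `j ∈ A` this is
impossible, since `e^{-1}` does not have modulus one; for `j ∉ A` it identifies the frequency. -/
theorem IsVacuum.hasType [CompleteSpace H] {w : H} (hw : IsVacuum V p w) (hw0 : w ≠ 0)
    (h : ∀ j ∉ p.1, ∀ (t : ℝ≥0) x, V.op (Pi.single j t) x = phase p (Pi.single j t) • x) :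
    HasType V p := by
  intro j m
  constructor
  · intro hm
    have h1 : ∀ t : ℝ≥0, vacuumCoeff p (Pi.single j t) =
        (starRingEnd ℂ) (Complex.exp (Complex.I * ((t * m : ℝ) : ℂ))) := fun t => by
      have h2 : (inner ℂ (adjoint (V.op (Pi.single j t)) w) w : ℂ) =
          inner ℂ w (V.op (Pi.single j t) w) := ContinuousLinearMap.adjoint_inner_left _ _ _
      rw [hw, hm, inner_smul_left, inner_smul_right] at h2
      have h3 := mul_right_cancel₀ (inner_self_ne_zero.2 hw0) h2
      rw [← h3, Complex.conj_conj]
    by_cases hj : j ∈ p.1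
    · have h2 := congrArg norm (h1 1)
      rw [vacuumCoeff_single_of_mem p hj, RCLike.norm_conj, mul_comm Complex.I,
        Complex.norm_exp_ofReal_mul_I, Complex.norm_real, Real.norm_eq_abs, Real.abs_exp,
        Real.exp_eq_one_iff] at h2
      norm_num at h2
    · refine ⟨hj, eq_of_forall_exp_eq fun t => ?_⟩
      have h2 := h1 t
      rw [vacuumCoeff_single_of_notMem p hj, phase_single_of_notMem p hj] at h2
      exact (starRingEnd ℂ).injective h2
  · rintro ⟨hj, rfl⟩ t x
    rw [h j hj, phase_single_of_notMem p hj]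

end

theorem irredRep_hasType (p : Param d) : HasType (irredRep p) p :=
  (irredRep_isVacuum p).hasType expVector_ne_zero fun _ hj t x =>
    irredRep_op_single_of_notMem p hj t x

theorem IsInfiniteMultiple.isScalarAt_iff {H H' : Type*} [NormedAddCommGroup H]
    [InnerProductSpace ℂ H] [CompleteSpace H] [NormedAddCommGroup H'] [InnerProductSpace ℂ H']
    [CompleteSpace H'] {V : IsoRep (Fin d → ℝ≥0) H} {W : IsoRep (Fin d → ℝ≥0) H'}
    (h : IsInfiniteMultiple V W) (j : Fin d) (m : ℝ) : IsScalarAt V j m ↔ IsScalarAt W j m := by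
  constructor
  · intro hV t x
    obtain ⟨J, hJ, -⟩ := h.exists_intertwining
    apply J.injective
    rw [hJ, hV, map_smul]
  · intro hW t x
    obtain ⟨U, hU⟩ := h
    apply U.injective
    ext n
    rw [hU, hW, map_smul]
    rfl

theorem modelRep_tensorOne_hasType (p : Param d) (K : Type*) [NormedAddCommGroup K]
    [InnerProductSpace ℂ K] [TopologicalSpace.SeparableSpace K] (hK : ¬ FiniteDimensional ℂ K) :
    HasType ((modelRep p).tensorOne K) p := fun j m =>
  ((modelRep_tensorOne_isInfiniteMultiple p K hK).isScalarAt_iff j m).trans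
    (irredRep_hasType p j m)

end Classification

/-! ### The Fell topology -/

section Topology

variable {S : Type*} [AddMonoid S] [TopologicalSpace S]
variable {H : Type*} [NormedAddCommGroup H] [InnerProductSpace ℂ H]

variable {d : ℕ}

/-- The classes of representations in which the coordinate semigroup `j` is the character with
frequency `m`. -/
def scalarClasses (H : Type*) [NormedAddCommGroup H] [InnerProductSpace ℂ H] (j : Fin d) (m : ℝ) :
    Set (RailwayClass (Fin d → ℝ≥0) H) :=
  {c | ∃ V : Railway (Fin d → ℝ≥0) H, V.cls = c ∧ IsScalarAt V.1 j m}

theorem cls_mem_scalarClasses {V : Railway (Fin d → ℝ≥0) H} {j : Fin d} {m : ℝ} :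
    V.cls ∈ scalarClasses H j m ↔ IsScalarAt V.1 j m := by
  constructor
  · rintro ⟨W, hWV, hW⟩
    exact UnitarilyEquiv.isScalarAt (Quotient.exact hWV) hW
  · exact fun h => ⟨V, rfl, h⟩

variable [CompleteSpace H]

theorem isOpen_basicSet (V : Railway S H) {K : Set S} (hK : IsCompact K) {ε : ℝ} (hε : 0 < ε)
    {F : Finset H} (hF : F.Nonempty) : IsOpen (basicSet V K ε F) :=
  TopologicalSpace.isOpen_generateFrom_of_mem ⟨V, K, ε, F, hK, hε, hF, rfl⟩

/-- Orbit maps are continuous on the set of railway representations. -/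
theorem continuous_railway_op (s : S) (x : H) : Continuous fun V : Railway S H => V.1.op s x := by
  rw [Metric.continuous_iff']
  intro V ε hε
  have hV : V ∈ basicSet V {s} ε {x} := ⟨0, hε, fun y _ t _ => by simp⟩
  filter_upwards [(isOpen_basicSet V isCompact_singleton hε
    (Finset.singleton_nonempty x)).mem_nhds hV] with W hW
  obtain ⟨δ, hδ, hW⟩ := hW
  rw [dist_eq_norm, norm_sub_rev]
  exact (hW x (Finset.mem_singleton_self x) s rfl).1.trans_lt hδ

/-- The preimage in the railway representations is cut out by equations between continuous functions
of `V`. These closed sets separate the points in the proof of `T₀`. -/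
theorem isClosed_scalarClasses (j : Fin d) (m : ℝ) : IsClosed (scalarClasses H j m) := by
  have hq : Topology.IsQuotientMap
      (Railway.cls : Railway (Fin d → ℝ≥0) H → RailwayClass (Fin d → ℝ≥0) H) :=
    isQuotientMap_quotient_mk'
  rw [← hq.isClosed_preimage]
  have : Railway.cls ⁻¹' scalarClasses H j m = ⋂ (t : ℝ≥0) (x : H),
      {V : Railway (Fin d → ℝ≥0) H | V.1.op (Pi.single j t) x =
        Complex.exp (Complex.I * ((t * m : ℝ) : ℂ)) • x} := by
    ext V
    rw [Set.mem_preimage, cls_mem_scalarClasses]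
    simp [IsScalarAt]
  rw [this]
  exact isClosed_iInter fun t => isClosed_iInter fun x =>
    isClosed_eq (continuous_railway_op _ x) continuous_const

end Topology

end FellTop

end

theorem mainTheorem4 (d : ℕ) (K : Type*) [NormedAddCommGroup K] [InnerProductSpace ℂ K]
    [CompleteSpace K] [TopologicalSpace.SeparableSpace K] (hK : ¬ FiniteDimensional ℂ K) :
    -- the irreducible doubly commuting isometric representations, up to unitary equivalence
    (∀ p : FellTop.Param d,
      FellTop.IsIrred (FellTop.irredRep p) ∧ FellTop.DoublyCommuting (FellTop.irredRep p)) ∧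
    (∀ (E : Type*) [NormedAddCommGroup E] [InnerProductSpace ℂ E] [CompleteSpace E]
        [TopologicalSpace.SeparableSpace E] (V : FellTop.IsoRep (Fin d → NNReal) E),
      FellTop.IsIrred V → FellTop.DoublyCommuting V →
        ∃! p : FellTop.Param d, FellTop.UnitarilyEquiv V (FellTop.irredRep p)) ∧
    -- the representations `V^{(A,λ)} ⊗ 1` are doubly commuting railway representations, and
    -- `Ψ : (A, λ) ↦ [V^{(A,λ)} ⊗ 1]` is a bijection onto the set of classes of such
    (∃ h : ∀ p : FellTop.Param d,
        FellTop.IsRailway ((FellTop.modelRep p).tensorOne K) ∧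
        FellTop.DoublyCommuting ((FellTop.modelRep p).tensorOne K),
      Function.Bijective (fun p : FellTop.Param d =>
        (⟨FellTop.Railway.cls ⟨(FellTop.modelRep p).tensorOne K, (h p).1⟩,
            ⟨_, rfl, (h p).2⟩⟩ :
          FellTop.R₀ d (FellTop.HilbertTensor (FellTop.L2Cone (Fin d)) K)))) ∧
    -- the Fell topology is T₀
    T0Space (FellTop.R₀ d (FellTop.HilbertTensor (FellTop.L2Cone (Fin d)) K)) := by
  have hmult := fun p : FellTop.Param d => FellTop.modelRep_tensorOne_isInfiniteMultiple p K hK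
  have htype := fun p : FellTop.Param d => FellTop.modelRep_tensorOne_hasType p K hK
  have h : ∀ p : FellTop.Param d,
      FellTop.IsRailway ((FellTop.modelRep p).tensorOne K) ∧
      FellTop.DoublyCommuting ((FellTop.modelRep p).tensorOne K) := fun p =>
    ⟨(hmult p).isRailway (FellTop.irredRep_isIrred p),
      (FellTop.modelRep_doublyCommuting p).tensorOne⟩
  have hsurj : ∀ c : FellTop.R₀ d (FellTop.HilbertTensor (FellTop.L2Cone (Fin d)) K),
      ∃ p, FellTop.Railway.cls ⟨(FellTop.modelRep p).tensorOne K, (h p).1⟩ = c.1 := by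
    rintro ⟨_, ⟨V, ⟨E, _, _, _, V₀, hirr, hV₀⟩⟩, rfl, hD⟩
    obtain ⟨p, hp⟩ := hirr.exists_unitarilyEquiv_irredRep (hV₀.doublyCommuting hD)
    -- Both are infinite multiples of `irredRep p`, hence equivalent to each other.
    exact ⟨p, Quotient.sound ((hmult p).unitarilyEquiv (hV₀.congr_right hp))⟩
  refine ⟨fun p => ⟨FellTop.irredRep_isIrred p, FellTop.irredRep_doublyCommuting p⟩, ?_,
    ⟨h, fun p q hpq => ?_, fun c => ?_⟩, ⟨fun x y hxy => ?_⟩⟩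
  · intro E _ _ _ _ V hV hD
    obtain ⟨p, hp⟩ := hV.exists_unitarilyEquiv_irredRep hD
    refine ⟨p, hp, fun q hq => ?_⟩
    exact FellTop.eq_of_forall_isScalarAt_iff (hq.hasType (FellTop.irredRep_hasType q))
      (hp.hasType (FellTop.irredRep_hasType p)) fun _ _ => Iff.rfl
  · have hequiv : FellTop.UnitarilyEquiv _ _ := Quotient.exact (congrArg Subtype.val hpq)
    exact FellTop.eq_of_forall_isScalarAt_iff (htype p) (htype q) hequiv.isScalarAt_iff
  · obtain ⟨p, hp⟩ := hsurj c
    exact ⟨p, Subtype.ext hp⟩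
  · obtain ⟨p, hp⟩ := hsurj x
    obtain ⟨q, hq⟩ := hsurj y
    have hpq : p = q := FellTop.eq_of_forall_isScalarAt_iff (htype p) (htype q) fun j m => by
      -- Topologically indistinguishable points lie in the same closed sets, so they share the
      -- invariant and therefore the parameter.
      have h1 : x.1 ∈ FellTop.scalarClasses _ j m ↔ y.1 ∈ FellTop.scalarClasses _ j m :=
        (hxy.map continuous_subtype_val).mem_closed_iff (FellTop.isClosed_scalarClasses j m)
      rw [← hp, ← hq] at h1
      exact FellTop.cls_mem_scalarClasses.symm.trans (h1.trans FellTop.cls_mem_scalarClasses)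
    subst hpq
    exact Subtype.ext (hp.symm.trans hq)
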